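/- **Conventions.** Let $n\ge 0$ and $f=\sum_\alpha f_\alpha x^\alpha\in\mathbb R[x_1,\dots,x_n]$. Put $\Lambda(f)=\{\alpha\in(2\mathbb N)^n: f_\alpha>0\}$ and $\Gamma(f)=\operatorname{supp}(f)\setminus\Lambda(f)$. Call $f$ a *PN-polynomial* if $f_\beta<0$ for all $\beta\in\Gamma(f)$. A pair $(\mathcal T,\beta)$ is a *circuit* if $\mathcal T\subseteq(2\mathbb N)^n$ is the vertex set of a simplex (of any dimension) and $\beta\in\mathbb N^n$ lies in the relative interior of $\operatorname{conv}(\mathcal T)$. A *nonnegative circuit* is either a polynomial $\sum_{\alpha\in\mathcal T}c_\alpha x^\alpha-d\,x^\beta$ that is nonnegative on $\mathbb R^n$, where $(\mathcal T,\beta)$ is a circuit, all $c_\alpha>0$ and $d\in\mathbb R$, or the square of a monomial term; $f$ is *SONC* if it is a finite sum of nonnegative circuits. For $\beta\in\Gamma(f)$ let $\mathcal C(\beta)$ be the set of all $\mathcal T\subseteq\Lambda(f)$ such that $(\mathcal T,\beta)$ is a circuit, and let $\tilde{\mathcal A}$ be the set of $\alpha\in\Lambda(f)$ that lie in no $\mathcal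 T\in\mathcal C(\beta)$, $\beta\in\Gamma(f)$. For a finite set $\mathcal T\subseteq\mathbb Q^n$, a finite set $M\subseteq\mathbb Q^n$ is a *$\mathcal T$-rational mediated set* if $\mathcal T\subseteq M$ and every $u\in M\setminus\mathcal T$ is the midpoint of two distinct points of $M$. Identities between expressions with rational exponents are identities of formal real linear combinations of monomials $x^q$, $q\in\mathbb Q^n$, with $x^px^q=x^{p+q}$. **Theorem.** Let $f$ be a PN-polynomial. For every $\beta\in\Gamma(f)$ and $\mathcal T\in\mathcal C(\beta)$ let $M_{\mathcal T\beta}$ be an arbitrary $\mathcal T$-rational mediated set containing $\beta$ (with no parity condition on denominators), and for every $u\in M_{\mathcal T\beta}\setminus\mathcal T$ let $v\neq w$ in $M_{\mathcal T\beta}$, depending on $(\beta,\mathcal T,u)$, be arbitrary points with $u=\tfrac12(v+w)$. Let $M=\bigcup_{\beta\in\Gamma(f)}\bigcup_{\mathcal T\in\mathcal C(\beta)}M_{\mathcal T\beta}$. Then the following hold. 1. $f$ is SONC if and only if there are real numbers $a_{\beta\mathcal T u j},b_{\beta\mathcal T u j}$ such that $$f=\sum_{\beta\in\Gamma(f)}\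 \sum_{\mathcal T\in\mathcal C(\beta)}\ \sum_{u\in M_{\mathcal T\beta}\setminus\mathcal T}\ \sum_{j=1}^{2}\bigl(a_{\beta\mathcal T uj}\,x^{\frac12 v}-b_{\beta\mathcal T uj}\,x^{\frac12 w}\bigr)^2+\sum_{\alpha\in\tilde{\mathcal A}}f_\alpha x^\alpha .$$ (The inner sum over $j$ is an arbitrary positive semidefinite quadratic form in $x^{\frac12 v},x^{\frac12 w}$.) 2. $f$ is SONC if and only if $f=\sum_{j=1}^N(a_jx^{\frac12p_j}-b_jx^{\frac12q_j})^2+\sum_{\alpha\in\tilde{\mathcal A}}f_\alpha x^\alpha$ for some $N\ge 0$, $p_j,q_j\in M$ and $a_j,b_j\in\mathbb R$. 3. For every positive integer $k$, $f$ is SONC if and only if $f(x_1^k,\dots,x_n^k)$ is SONC. -/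

import Mathlib

noncomputable section

open scoped Classical in
/-- `Λ(f)`: the exponents in `(2ℕ)ⁿ` whose coefficient in `f` is positive. -/
def posSupport {n : ℕ} (f : MvPolynomial (Fin n) ℝ) : Finset (Fin n →₀ ℕ) :=
  f.support.filter (fun α => (∀ i, Even (α i)) ∧ 0 < f.coeff α)

open scoped Classical in
/-- `Γ(f) = supp(f) \ Λ(f)`. -/
def negSupport {n : ℕ} (f : MvPolynomial (Fin n) ℝ) : Finset (Fin n →₀ ℕ) :=
  f.support \ posSupport f

/-- `f` is a PN-polynomial: writing `f = ∑_{α ∈ Λ(f)} c_α x^α - ∑_{β ∈ Γ(f)} d_β x^β`, all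
`d_β = -coeff_β(f)` are positive. -/
def IsPNPolynomial {n : ℕ} (f : MvPolynomial (Fin n) ℝ) : Prop :=
  ∀ β ∈ negSupport f, 0 < -f.coeff β

/-- `(T, β)` is a circuit: `T ⊆ (2ℕ)ⁿ` is the vertex set of a simplex (i.e. is affinely
independent), and `β` is a lattice point of the relative interior of that simplex (i.e. a
convex combination of the vertices all of whose weights are positive). -/
structure IsCircuit {n : ℕ} (T : Finset (Fin n →₀ ℕ)) (β : Fin n →₀ ℕ) : Prop where
  even : ∀ α ∈ T, ∀ i, Even (α i)
  affineIndependent :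
    AffineIndependent ℝ (fun (α : T) (i : Fin n) => ((α : Fin n →₀ ℕ) i : ℝ))
  mem_interior : ∃ l : (Fin n →₀ ℕ) → ℝ, (∀ α ∈ T, 0 < l α) ∧ ∑ α ∈ T, l α = 1 ∧
    ∀ i, ∑ α ∈ T, l α * (α i : ℝ) = (β i : ℝ)

/-- `p = ∑_{α ∈ T} c_α x^α - d x^β` with `(T, β)` a circuit and all `c_α` positive. -/
def IsCircuitPolynomial {n : ℕ} (p : MvPolynomial (Fin n) ℝ) : Prop :=
  ∃ (T : Finset (Fin n →₀ ℕ)) (β : Fin n →₀ ℕ) (c : (Fin n →₀ ℕ) → ℝ) (d : ℝ),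
    IsCircuit T β ∧ (∀ α ∈ T, 0 < c α) ∧
      p = ∑ α ∈ T, MvPolynomial.monomial α (c α) - MvPolynomial.monomial β d

/-- A nonnegative circuit: a circuit polynomial that is nonnegative on `ℝⁿ`, or a monomial
square. -/
def IsNonnegCircuit {n : ℕ} (p : MvPolynomial (Fin n) ℝ) : Prop :=
  (IsCircuitPolynomial p ∧ ∀ x : Fin n → ℝ, 0 ≤ MvPolynomial.eval x p) ∨
    ∃ (γ : Fin n →₀ ℕ) (a : ℝ), p = (MvPolynomial.monomial γ a) ^ 2

/-- `f` is a (finite) sum of nonnegative circuits. -/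
def IsSONC {n : ℕ} (f : MvPolynomial (Fin n) ℝ) : Prop :=
  ∃ (N : ℕ) (g : Fin N → MvPolynomial (Fin n) ℝ), (∀ j, IsNonnegCircuit (g j)) ∧ f = ∑ j, g j

open scoped Classical in
/-- `𝒞(β)`: the sets `T ⊆ Λ(f)` such that `(T, β)` is a circuit. -/
def circuitsAt {n : ℕ} (f : MvPolynomial (Fin n) ℝ) (β : Fin n →₀ ℕ) :
    Finset (Finset (Fin n →₀ ℕ)) :=
  (posSupport f).powerset.filter (fun T => IsCircuit T β)

open scoped Classical in
/-- `Ã`: the exponents in `Λ(f)` that lie in no `T ∈ 𝒞(β)`, for any `β ∈ Γ(f)`. -/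
def uncoveredSupport {n : ℕ} (f : MvPolynomial (Fin n) ℝ) : Finset (Fin n →₀ ℕ) :=
  (posSupport f).filter (fun α => ∀ β ∈ negSupport f, ∀ T ∈ circuitsAt f β, α ∉ T)

/-- A lattice point as a point of `ℚⁿ`. -/
def ratPoint {n : ℕ} (α : Fin n →₀ ℕ) : Fin n → ℚ := fun i => (α i : ℚ)

open scoped Classical in
/-- A set of lattice points as a set of points of `ℚⁿ`. -/
def ratPoints {n : ℕ} (T : Finset (Fin n →₀ ℕ)) : Finset (Fin n → ℚ) := T.image ratPoint

/-- `M` is a (finite) `T`-rational mediated set: `T ⊆ M`, and every point of `M` is in `T` or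
is the midpoint of two distinct points of `M`. -/
def IsRationalMediatedSet {n : ℕ} (T M : Finset (Fin n → ℚ)) : Prop :=
  T ⊆ M ∧ ∀ u ∈ M, u ∈ T ∨ ∃ v ∈ M, ∃ w ∈ M, v ≠ w ∧ u = (1 / 2 : ℚ) • (v + w)

/-- Real polynomials with rational exponents: the algebra with basis the formal monomials
`x^q`, `q ∈ ℚⁿ`, and product `x^p * x^q = x^(p+q)`. -/
abbrev RatExpPoly (n : ℕ) : Type := AddMonoidAlgebra ℝ (Fin n → ℚ)

/-- The term `c x^q`. -/
def ratTerm {n : ℕ} (q : Fin n → ℚ) (c : ℝ) : RatExpPoly n := AddMonoidAlgebra.single q c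

/-- An ordinary polynomial as a polynomial with rational exponents. -/
def toRatExpPoly {n : ℕ} (f : MvPolynomial (Fin n) ℝ) : RatExpPoly n :=
  ∑ α ∈ f.support, ratTerm (ratPoint α) (f.coeff α)

/-- The binomial square `(a x^(v/2) - b x^(w/2))²`. -/
def binomialSquare {n : ℕ} (v w : Fin n → ℚ) (a b : ℝ) : RatExpPoly n :=
  (ratTerm ((1 / 2 : ℚ) • v) a - ratTerm ((1 / 2 : ℚ) • w) b) ^ 2

end

noncomputable section

/-! ### Polynomials with rational exponents -/

/-! Everything is compared with one cone of formal polynomials with rational exponents, `sageCone`: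
sums of polynomials that are nonnegative on the positive orthant and have at most one negative
coefficient. Neither parity nor denominators of exponents enter its definition. Nonnegative circuits
and binomial squares both lie in it, the latter because only the cross term can be negative.

For a PN-polynomial the cone is no larger than SONC (`IsPNPolynomial.isSONC_iff`). Negative
coefficients can be eliminated from foreign summands, so each β ∈ Γ(f) receives a single AGE summand
whose other exponents lie in Λ(f) (`exists_isAGE_noncancelling`, `IsPNPolynomial.exists_split`).
Nonnegativity of such a summand has a relative entropy certificate: a nonnegative measure ν on Λ(f),
balanced around β (`exists_entropy_certificate`). Carathéodory's theorem peels ν into measures on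
simplices, and the summand accordingly into circuits with vertices in Λ(f), plus positive monomials.
Part 3 follows because scaling all exponents is invertible on `sageCone`.

For parts 1 and 2 each circuit becomes a sum of binomial squares along its mediated set. On that
set, "value minus mean of the values at v and w" is a discrete Laplacian with boundary 𝒯. A minimum
principle gives a nonnegative Green function, and the resulting Poisson formula at β supplies the
weights of the squares (`exists_green`, `IsCircuit.mem_binomialSquareCone`). Affine interpolation of
logarithms first normalizes the circuit coefficients to barycentric coordinates. -/

lemma ratPoint_injective {n : ℕ} : Function.Injective (ratPoint (n := n)) := by
  intro α β h
  ext i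
  have := congrFun h i
  simpa [ratPoint] using this

lemma toRatExpPoly_eq_sum {n : ℕ} (f : MvPolynomial (Fin n) ℝ) {S : Finset (Fin n →₀ ℕ)}
    (hS : f.support ⊆ S) : toRatExpPoly f = ∑ α ∈ S, ratTerm (ratPoint α) (f.coeff α) := by
  refine Finset.sum_subset hS fun α _ hα => ?_
  simp [MvPolynomial.notMem_support_iff.mp hα, ratTerm]

/-- `toRatExpPoly` as an additive homomorphism. -/
def toRatHom (n : ℕ) : MvPolynomial (Fin n) ℝ →+ RatExpPoly n where
  toFun := toRatExpPoly
  map_zero' := by simp [toRatExpPoly]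
  map_add' f g := by
    classical
    rw [toRatExpPoly_eq_sum (f + g) (MvPolynomial.support_add (p := f) (q := g)),
      toRatExpPoly_eq_sum f (S := f.support ∪ g.support) Finset.subset_union_left,
      toRatExpPoly_eq_sum g (S := f.support ∪ g.support) Finset.subset_union_right,
      ← Finset.sum_add_distrib]
    simp [ratTerm, AddMonoidAlgebra.single_add]

@[simp] lemma toRatHom_apply {n : ℕ} (f : MvPolynomial (Fin n) ℝ) :
    toRatHom n f = toRatExpPoly f := rfl

lemma toRatHom_monomial {n : ℕ} (α : Fin n →₀ ℕ) (c : ℝ) :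
    toRatHom n (MvPolynomial.monomial α c) = ratTerm (ratPoint α) c := by
  classical
  rw [toRatHom_apply, toRatExpPoly_eq_sum (S := {α}) _ MvPolynomial.support_monomial_subset]
  simp

lemma coeff_ratTerm {n : ℕ} (p q : Fin n → ℚ) (c : ℝ) :
    (ratTerm p c).coeff q = if p = q then c else 0 := by
  classical
  rw [ratTerm, AddMonoidAlgebra.coeff_single, Finsupp.single_apply]

lemma ratTerm_add {n : ℕ} (p : Fin n → ℚ) (c d : ℝ) :
    ratTerm p (c + d) = ratTerm p c + ratTerm p d := AddMonoidAlgebra.single_add _ _ _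

lemma ratTerm_mul {n : ℕ} (p q : Fin n → ℚ) (c d : ℝ) :
    ratTerm p c * ratTerm q d = ratTerm (p + q) (c * d) :=
  AddMonoidAlgebra.single_mul_single _ _ _ _

lemma coeff_toRatExpPoly {n : ℕ} (f : MvPolynomial (Fin n) ℝ) (α : Fin n →₀ ℕ) :
    (toRatExpPoly f).coeff (ratPoint α) = f.coeff α := by
  classical
  rw [toRatExpPoly_eq_sum f (S := insert α f.support) (Finset.subset_insert _ _),
    AddMonoidAlgebra.coeff_sum, Finset.sum_apply',
    Finset.sum_eq_single_of_mem α (Finset.mem_insert_self _ _)]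
  · simp [coeff_ratTerm]
  · intro b _ hb
    simp [coeff_ratTerm, ratPoint_injective.ne hb]

lemma coeff_toRatExpPoly_of_notMem {n : ℕ} (f : MvPolynomial (Fin n) ℝ) (q : Fin n → ℚ)
    (hq : ∀ α ∈ f.support, ratPoint α ≠ q) : (toRatExpPoly f).coeff q = 0 := by
  classical
  rw [toRatExpPoly, AddMonoidAlgebra.coeff_sum, Finset.sum_apply']
  exact Finset.sum_eq_zero fun α hα => by simp [coeff_ratTerm, hq α hα]

/-- Evaluation of a polynomial with rational exponents at the positive point `exp y`. -/
def expEval {n : ℕ} (y : Fin n → ℝ) : RatExpPoly n →ₐ[ℝ] ℝ :=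
  AddMonoidAlgebra.lift ℝ ℝ (Fin n → ℚ)
    { toFun := fun q => Real.exp (∑ i, (q.toAdd i : ℝ) * y i)
      map_one' := by simp
      map_mul' := fun p q => by
        simp [← Real.exp_add, ← Finset.sum_add_distrib, add_mul] }

lemma expEval_ratTerm {n : ℕ} (y : Fin n → ℝ) (q : Fin n → ℚ) (c : ℝ) :
    expEval y (ratTerm q c) = c * Real.exp (∑ i, (q i : ℝ) * y i) := by
  simp [expEval, ratTerm]

lemma expEval_toRatExpPoly {n : ℕ} (y : Fin n → ℝ) (f : MvPolynomial (Fin n) ℝ) :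
    expEval y (toRatExpPoly f) = MvPolynomial.eval (fun i => Real.exp (y i)) f := by
  rw [toRatExpPoly, map_sum, MvPolynomial.eval_eq']
  refine Finset.sum_congr rfl fun α _ => ?_
  rw [expEval_ratTerm, Real.exp_sum]
  simp [ratPoint, Real.exp_nat_mul]

/-- `p` has nonnegative coefficients except possibly at `β`, and is nonnegative on the positive
orthant. -/
def IsAGE {n : ℕ} (β : Fin n → ℚ) (p : RatExpPoly n) : Prop :=
  (∀ q, q ≠ β → 0 ≤ p.coeff q) ∧ ∀ y, 0 ≤ expEval y p

/-- The cone of sums of polynomials that are nonnegative on the positive orthant and have at most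
one negative coefficient. -/
def sageCone (n : ℕ) : AddSubmonoid (RatExpPoly n) :=
  AddSubmonoid.closure {p | ∃ β, IsAGE β p}

lemma IsAGE.zero {n : ℕ} (β : Fin n → ℚ) : IsAGE β (0 : RatExpPoly n) :=
  ⟨fun q _ => by simp, fun y => by simp⟩

lemma IsAGE.add {n : ℕ} {β : Fin n → ℚ} {p q : RatExpPoly n} (hp : IsAGE β p) (hq : IsAGE β q) :
    IsAGE β (p + q) :=
  ⟨fun r hr => by simpa using add_nonneg (hp.1 r hr) (hq.1 r hr),
    fun y => by simpa using add_nonneg (hp.2 y) (hq.2 y)⟩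

lemma IsAGE.smul {n : ℕ} {β : Fin n → ℚ} {p : RatExpPoly n} (hp : IsAGE β p) {c : ℝ}
    (hc : 0 ≤ c) : IsAGE β (c • p) :=
  ⟨fun r hr => by simpa using mul_nonneg hc (hp.1 r hr),
    fun y => by simpa using mul_nonneg hc (hp.2 y)⟩

lemma IsAGE.ratTerm {n : ℕ} (β q : Fin n → ℚ) {c : ℝ} (hc : 0 ≤ c) : IsAGE β (ratTerm q c) := by
  refine ⟨fun r _ => ?_, fun y => ?_⟩
  · rw [coeff_ratTerm]; split_ifs <;> simp [hc]
  · rw [expEval_ratTerm]; positivity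

lemma IsAGE.mem {n : ℕ} {β : Fin n → ℚ} {p : RatExpPoly n} (hp : IsAGE β p) : p ∈ sageCone n :=
  AddSubmonoid.subset_closure ⟨β, hp⟩

lemma binomialSquare_eq {n : ℕ} (v w : Fin n → ℚ) (a b : ℝ) :
    binomialSquare v w a b = ratTerm v (a ^ 2) + ratTerm w (b ^ 2)
      - ratTerm ((1 / 2 : ℚ) • (v + w)) (2 * a * b) := by
  have hv : (1 / 2 : ℚ) • v + (1 / 2 : ℚ) • v = v := by rw [← add_smul]; norm_num
  have hw : (1 / 2 : ℚ) • w + (1 / 2 : ℚ) • w = w := by rw [← add_smul]; norm_num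
  have e : ratTerm ((1 / 2 : ℚ) • (v + w)) (2 * a * b)
      = ratTerm ((1 / 2 : ℚ) • (v + w)) (a * b) + ratTerm ((1 / 2 : ℚ) • (v + w)) (a * b) := by
    rw [← ratTerm_add]; ring_nf
  rw [binomialSquare, sub_sq, mul_assoc, sq, sq, ratTerm_mul, ratTerm_mul, ratTerm_mul, hv, hw, e,
    smul_add, sq, sq]
  ring

lemma binomialSquare_mem_sageCone {n : ℕ} (v w : Fin n → ℚ) (a b : ℝ) :
    binomialSquare v w a b ∈ sageCone n := by
  refine IsAGE.mem (β := (1 / 2 : ℚ) • (v + w)) ⟨fun q hq => ?_, fun y => ?_⟩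
  · rw [binomialSquare_eq]
    simp only [AddMonoidAlgebra.coeff_sub, AddMonoidAlgebra.coeff_add, Finsupp.coe_sub,
      Finsupp.coe_add, Pi.sub_apply, Pi.add_apply, coeff_ratTerm, if_neg hq.symm]
    have ha := sq_nonneg a
    have hb := sq_nonneg b
    split_ifs <;> linarith
  · rw [binomialSquare, map_pow]
    positivity

/-- A member of the SAGE cone is a sum of AGE polynomials with distinct distinguished exponents. -/
lemma exists_finsupp_of_mem_sageCone {n : ℕ} {p : RatExpPoly n} (hp : p ∈ sageCone n) :
    ∃ h : (Fin n → ℚ) →₀ RatExpPoly n, (∀ β, IsAGE β (h β)) ∧ p = h.sum fun _ g => g := by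
  classical
  induction hp using AddSubmonoid.closure_induction with
  | mem p hp =>
    obtain ⟨β, hβ⟩ := hp
    refine ⟨Finsupp.single β p, fun γ => ?_, by simp⟩
    rw [Finsupp.single_apply]
    split_ifs with h
    · exact h ▸ hβ
    · exact IsAGE.zero γ
  | zero => exact ⟨0, fun β => IsAGE.zero β, by simp⟩
  | add p q _ _ ihp ihq =>
    obtain ⟨h, h1, rfl⟩ := ihp
    obtain ⟨k, k1, rfl⟩ := ihq
    exact ⟨h + k, fun β => (h1 β).add (k1 β),
      (Finsupp.sum_add_index' (fun _ => rfl) fun _ _ _ => rfl).symm⟩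

/-- Multiplication of all exponents by `r`. -/
def scaleExp (n : ℕ) (r : ℚ) : RatExpPoly n →+ RatExpPoly n :=
  (AddMonoidAlgebra.mapDomainRingHom ℝ (DistribSMul.toAddMonoidHom (Fin n → ℚ) r)).toAddMonoidHom

lemma scaleExp_ratTerm {n : ℕ} (r : ℚ) (q : Fin n → ℚ) (c : ℝ) :
    scaleExp n r (ratTerm q c) = ratTerm (r • q) c := by
  simp [scaleExp, ratTerm]

lemma scaleExp_scaleExp {n : ℕ} {r : ℚ} (hr : r ≠ 0) (p : RatExpPoly n) :
    scaleExp n r⁻¹ (scaleExp n r p) = p := by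
  induction p using AddMonoidAlgebra.induction_linear with
  | zero => simp
  | add p q hp hq => rw [map_add, map_add, hp, hq]
  | single q c =>
    change scaleExp n r⁻¹ (scaleExp n r (ratTerm q c)) = ratTerm q c
    rw [scaleExp_ratTerm, scaleExp_ratTerm, smul_smul, inv_mul_cancel₀ hr, one_smul]

lemma coeff_scaleExp {n : ℕ} {r : ℚ} (hr : r ≠ 0) (p : RatExpPoly n) (q : Fin n → ℚ) :
    (scaleExp n r p).coeff q = p.coeff (r⁻¹ • q) := by
  induction p using AddMonoidAlgebra.induction_linear with
  | zero => simp
  | add p q hp hq => simp [hp, hq]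
  | single s c =>
    change (scaleExp n r (ratTerm s c)).coeff q = (ratTerm s c).coeff _
    rw [scaleExp_ratTerm, coeff_ratTerm, coeff_ratTerm]
    simp only [eq_inv_smul_iff₀ hr]

lemma expEval_scaleExp {n : ℕ} (r : ℚ) (y : Fin n → ℝ) (p : RatExpPoly n) :
    expEval y (scaleExp n r p) = expEval (fun i => (r : ℝ) * y i) p := by
  induction p using AddMonoidAlgebra.induction_linear with
  | zero => simp
  | add p q hp hq => simp [hp, hq]
  | single s c =>
    change expEval y (scaleExp n r (ratTerm s c)) = expEval _ (ratTerm s c)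
    rw [scaleExp_ratTerm, expEval_ratTerm, expEval_ratTerm]
    congr 2
    refine Finset.sum_congr rfl fun i _ => ?_
    simp only [Pi.smul_apply, smul_eq_mul, Rat.cast_mul]
    ring

/-- In the coordinates x = exp y, scaling exponents by r is the substitution y ↦ r y, which
preserves nonnegativity; the coefficients are only relabelled. -/
lemma scaleExp_mem_sageCone {n : ℕ} {r : ℚ} (hr : r ≠ 0) {p : RatExpPoly n}
    (hp : p ∈ sageCone n) : scaleExp n r p ∈ sageCone n := by
  induction hp using AddSubmonoid.closure_induction with
  | mem p hp =>
    obtain ⟨β, hβ⟩ := hp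
    refine IsAGE.mem (β := r • β) ⟨fun q hq => ?_, fun y => ?_⟩
    · rw [coeff_scaleExp hr]
      refine hβ.1 _ fun h => hq ?_
      rw [← h, smul_inv_smul₀ hr]
    · rw [expEval_scaleExp]; exact hβ.2 _
  | zero => simp
  | add p q _ _ ihp ihq => rw [map_add]; exact add_mem ihp ihq

lemma scaleExp_mem_sageCone_iff {n : ℕ} {r : ℚ} (hr : r ≠ 0) {p : RatExpPoly n} :
    scaleExp n r p ∈ sageCone n ↔ p ∈ sageCone n :=
  ⟨fun h => scaleExp_scaleExp hr p ▸ scaleExp_mem_sageCone (inv_ne_zero hr) h,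
    scaleExp_mem_sageCone hr⟩

lemma toRatExpPoly_expand {n : ℕ} (k : ℕ) (f : MvPolynomial (Fin n) ℝ) :
    toRatExpPoly (MvPolynomial.expand k f) = scaleExp n k (toRatExpPoly f) := by
  rw [← toRatHom_apply, ← toRatHom_apply]
  induction f using MvPolynomial.induction_on' with
  | monomial α c =>
    rw [MvPolynomial.expand_monomial, toRatHom_monomial, toRatHom_monomial, scaleExp_ratTerm]
    congr 1
    ext i
    simp [ratPoint]
  | add f g hf hg => rw [map_add, map_add, map_add, map_add, hf, hg]

/-! ### Eliminating negative coefficients from a SAGE decomposition -/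

/-- One elimination step: the negative coefficient at `k` of the `k`-th summand is distributed over
the other summands. -/
lemma exists_isAGE_step {n : ℕ} {I : Finset (Fin n → ℚ)} {h : (Fin n → ℚ) → RatExpPoly n}
    (hage : ∀ i ∈ I, IsAGE i (h i)) {k : Fin n → ℚ} (hk : k ∈ I) (hneg : (h k).coeff k < 0) :
    ∃ (t : (Fin n → ℚ) → ℝ), (∀ i, i ≠ k → i ∈ I → 0 ≤ t i) ∧ -1 ≤ t k ∧ ∑ i ∈ I, t i = 0 ∧
      (∀ i ∈ I, i ≠ k → 0 ≤ (h i + t i • h k).coeff k) ∧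
      ((∑ i ∈ I, h i).coeff k < 0 → ∀ i ∈ I, i ≠ k → (h i + t i • h k).coeff k = 0) ∧
      (0 ≤ (∑ i ∈ I, h i).coeff k → t k = -1) := by
  classical
  set d := -(h k).coeff k with hd
  have hdpos : 0 < d := by linarith
  set S := ∑ i ∈ I.erase k, (h i).coeff k with hS
  have he : ∀ i ∈ I, i ≠ k → 0 ≤ (h i).coeff k := fun i hi hik => (hage i hi).1 k hik.symm
  have hS0 : 0 ≤ S := Finset.sum_nonneg fun i hi =>
    he i (Finset.mem_of_mem_erase hi) (Finset.ne_of_mem_erase hi)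
  have hsum : (∑ i ∈ I, h i).coeff k = S - d := by
    rw [AddMonoidAlgebra.coeff_sum, Finset.sum_apply', ← Finset.sum_erase_add _ _ hk, hS, hd]
    ring
  -- The total coefficient at k is S - d. Adding `(h i).coeff k / m` copies of `h k` multiplies the
  -- coefficient of `h i` at k by 1 - d/m. If m = d, this clears k from all other summands; if m =
  -- S, `h k` is used up entirely and t k = -1.
  set m := max S d with hm
  have hmpos : 0 < m := lt_max_of_lt_right hdpos
  have hcoeff : ∀ i, i ≠ k → (h i + ((h i).coeff k / m) • h k).coeff k
      = (h i).coeff k * (1 - d / m) := by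
    intro i _
    simp only [AddMonoidAlgebra.coeff_add, AddMonoidAlgebra.coeff_smul, Finsupp.coe_add,
      Finsupp.coe_smul, Pi.add_apply, Pi.smul_apply, smul_eq_mul]
    rw [show (h k).coeff k = -d by rw [hd, neg_neg]]
    ring
  refine ⟨fun i => if i = k then -(S / m) else (h i).coeff k / m, ?_, ?_, ?_, ?_, ?_, ?_⟩
  · intro i hik hi
    simp only [if_neg hik]
    exact div_nonneg (he i hi hik) hmpos.le
  · simp only [if_true]
    rw [neg_le_neg_iff, div_le_one hmpos]
    exact le_max_left _ _
  · rw [← Finset.sum_erase_add _ _ hk, if_pos rfl,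
      Finset.sum_congr rfl (fun i hi => if_neg (Finset.ne_of_mem_erase hi)), ← Finset.sum_div]
    ring
  · intro i hi hik
    simp only [if_neg hik]
    rw [hcoeff i hik]
    refine mul_nonneg (he i hi hik) ?_
    rw [sub_nonneg, div_le_one hmpos]
    exact le_max_right _ _
  · intro hlt i hi hik
    simp only [if_neg hik]
    have : m = d := max_eq_right (by linarith)
    rw [hcoeff i hik, this, div_self hdpos.ne', sub_self, mul_zero]
  · intro hle
    have : m = S := max_eq_left (by linarith)
    simp only [if_true]
    rw [this, div_self (by linarith)]

/-- The exponents in P are treated one at a time. A later step at k does not spoil an earlier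
exponent l: it adds multiples of `g k` to the other summands and rescales `g k` itself, and the
coefficient of `g k` at l is already zero (negative total) or nonnegative. -/
lemma exists_isAGE_eliminated {n : ℕ} (I : Finset (Fin n → ℚ))
    (h : (Fin n → ℚ) → RatExpPoly n) (hage : ∀ i ∈ I, IsAGE i (h i)) :
    ∀ P ⊆ I, ∃ g : (Fin n → ℚ) → RatExpPoly n, (∀ i ∈ I, IsAGE i (g i)) ∧
      ∑ i ∈ I, g i = ∑ i ∈ I, h i ∧
      (∀ k ∈ P, (∑ i ∈ I, h i).coeff k < 0 → ∀ i ∈ I, i ≠ k → (g i).coeff k = 0) ∧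
      (∀ k ∈ P, 0 ≤ (∑ i ∈ I, h i).coeff k → 0 ≤ (g k).coeff k) := by
  classical
  intro P
  induction P using Finset.induction_on with
  | empty => exact fun _ => ⟨h, hage, rfl, by simp, by simp⟩
  | insert k P hkP ih =>
    intro hPI
    obtain ⟨g, g1, g2, g3, g4⟩ := ih fun i hi => hPI (Finset.mem_insert_of_mem hi)
    have hkI : k ∈ I := hPI (Finset.mem_insert_self _ _)
    have hcs : ∀ q, (∑ i ∈ I, g i).coeff q = ∑ i ∈ I, (g i).coeff q := fun q => by
      rw [AddMonoidAlgebra.coeff_sum, Finset.sum_apply']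
    rcases le_or_gt 0 ((g k).coeff k) with hk0 | hk0
    -- All summands are now nonnegative at k, so the total is too and nothing has to be eliminated.
    · refine ⟨g, g1, g2, ?_, ?_⟩
      · intro l hl hneg
        rcases Finset.mem_insert.mp hl with rfl | hl
        · refine absurd hneg (not_lt.mpr ?_)
          rw [← g2, hcs]
          refine Finset.sum_nonneg fun i hi => ?_
          by_cases hil : i = l
          · exact hil ▸ hk0
          · exact (g1 i hi).1 l (Ne.symm hil)
        · exact g3 l hl hneg
      · intro l hl hpos
        rcases Finset.mem_insert.mp hl with rfl | hl
        · exact hk0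
        · exact g4 l hl hpos
    · obtain ⟨t, t1, t2, t3, t4, t5, t6⟩ := exists_isAGE_step g1 hkI hk0
      have hc : ∀ i q, (g i + t i • g k).coeff q = (g i).coeff q + t i * (g k).coeff q := by
        intro i q; simp
      have hself : g k + t k • g k = (1 + t k) • g k := by rw [add_smul, one_smul]
      have hk1 : 0 ≤ 1 + t k := by linarith
      refine ⟨fun i => g i + t i • g k, fun i hi => ?_, ?_, ?_, ?_⟩
      · by_cases hik : i = k
        · subst hik
          simp only [hself]
          exact (g1 i hi).smul hk1
        · refine ⟨fun q hq => ?_, fun y => ?_⟩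
          · by_cases hqk : q = k
            · exact hqk ▸ t4 i hi hik
            · rw [hc]
              exact add_nonneg ((g1 i hi).1 q hq) (mul_nonneg (t1 i hik hi) ((g1 k hkI).1 q hqk))
          · rw [map_add, map_smul]
            exact add_nonneg ((g1 i hi).2 y) (mul_nonneg (t1 i hik hi) ((g1 k hkI).2 y))
      · rw [Finset.sum_add_distrib, ← Finset.sum_smul, t3, zero_smul, add_zero, g2]
      · intro l hl hneg i hi hil
        rcases Finset.mem_insert.mp hl with rfl | hl
        · exact t5 (g2 ▸ hneg) i hi hil
        · rw [hc, g3 l hl hneg i hi hil, g3 l hl hneg k hkI (by rintro rfl; exact hkP hl)]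
          simp
      · intro l hl hpos
        rcases Finset.mem_insert.mp hl with rfl | hl
        · change 0 ≤ (g l + t l • g l).coeff l
          rw [hself, t6 (g2 ▸ hpos)]
          simp
        · have hlk : l ≠ k := ne_of_mem_of_not_mem hl hkP
          rw [hc]
          exact add_nonneg (g4 l hl hpos) (mul_nonneg
            (t1 l hlk (hPI (Finset.mem_insert_of_mem hl))) ((g1 k hkI).1 l hlk))

/-- A SAGE polynomial is a sum of AGE polynomials without cancellation. -/
lemma exists_isAGE_noncancelling {n : ℕ} {p : RatExpPoly n} (hp : p ∈ sageCone n) :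
    ∃ (I : Finset (Fin n → ℚ)) (g : (Fin n → ℚ) → RatExpPoly n), p.coeff.support ⊆ I ∧
      (∀ i ∈ I, IsAGE i (g i)) ∧ p = ∑ i ∈ I, g i ∧
      (∀ k, p.coeff k < 0 → ∀ i ∈ I, i ≠ k → (g i).coeff k = 0) ∧
      (∀ k, 0 ≤ p.coeff k → ∀ i ∈ I, 0 ≤ (g i).coeff k) := by
  classical
  obtain ⟨h, h1, h2⟩ := exists_finsupp_of_mem_sageCone hp
  set I := h.support ∪ p.coeff.support with hI
  have hsum : ∑ i ∈ I, h i = p := by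
    rw [h2]
    refine (Finset.sum_subset Finset.subset_union_left fun i _ hi => ?_).symm
    exact Finsupp.notMem_support_iff.mp hi
  obtain ⟨g, g1, g2, g3, g4⟩ := exists_isAGE_eliminated I h (fun i _ => h1 i) I subset_rfl
  rw [hsum] at g2 g3 g4
  refine ⟨I, g, Finset.subset_union_right, g1, g2.symm, fun k hk i hi hik => ?_,
    fun k hk i hi => ?_⟩
  · refine g3 k (Finset.mem_union_right _ ?_) hk i hi hik
    exact Finsupp.mem_support_iff.mpr hk.ne
  · by_cases hik : k = i
    · subst hik
      exact g4 k hi hk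
    · exact (g1 i hi).1 k hik

/-! ### PN-polynomials -/

lemma mem_posSupport {n : ℕ} {f : MvPolynomial (Fin n) ℝ} {α : Fin n →₀ ℕ} :
    α ∈ posSupport f ↔ (∀ i, Even (α i)) ∧ 0 < f.coeff α := by
  simp only [posSupport, Finset.mem_filter, MvPolynomial.mem_support_iff]
  exact ⟨fun h => h.2, fun h => ⟨h.2.ne', h⟩⟩

lemma mem_negSupport_of_coeff_neg {n : ℕ} {f : MvPolynomial (Fin n) ℝ} {β : Fin n →₀ ℕ}
    (h : f.coeff β < 0) : β ∈ negSupport f := by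
  classical
  rw [negSupport, Finset.mem_sdiff, mem_posSupport, MvPolynomial.mem_support_iff]
  exact ⟨h.ne, fun h' => lt_asymm h h'.2⟩

lemma IsPNPolynomial.mem_negSupport_iff {n : ℕ} {f : MvPolynomial (Fin n) ℝ}
    (hf : IsPNPolynomial f) {β : Fin n →₀ ℕ} : β ∈ negSupport f ↔ f.coeff β < 0 :=
  ⟨fun h => by have := hf β h; linarith, mem_negSupport_of_coeff_neg⟩

lemma IsPNPolynomial.mem_posSupport_iff {n : ℕ} {f : MvPolynomial (Fin n) ℝ}
    (hf : IsPNPolynomial f) {α : Fin n →₀ ℕ} : α ∈ posSupport f ↔ 0 < f.coeff α := by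
  classical
  refine ⟨fun h => (mem_posSupport.mp h).2, fun h => ?_⟩
  by_contra hα
  have : α ∈ negSupport f := by
    rw [negSupport, Finset.mem_sdiff, MvPolynomial.mem_support_iff]
    exact ⟨h.ne', hα⟩
  have := hf.mem_negSupport_iff.mp this
  linarith

/-- A positive coefficient of a PN-polynomial sits at an even exponent, and multiplying by any k
keeps it even. -/
lemma IsPNPolynomial.expand {n : ℕ} {f : MvPolynomial (Fin n) ℝ} (hf : IsPNPolynomial f) {k : ℕ}
    (hk : 0 < k) : IsPNPolynomial (MvPolynomial.expand k f) := by
  classical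
  intro β hβ
  rw [negSupport, Finset.mem_sdiff, MvPolynomial.support_expand _ hk.ne', Finset.mem_image] at hβ
  obtain ⟨⟨α, hα, rfl⟩, h2⟩ := hβ
  have hc : (MvPolynomial.expand k f).coeff (k • α) = f.coeff α :=
    MvPolynomial.coeff_expand_smul k hk.ne' f α
  rw [mem_posSupport, hc] at h2
  rw [hc]
  rcases lt_or_gt_of_ne (MvPolynomial.mem_support_iff.mp hα) with h | h
  · linarith
  · refine absurd ⟨fun i => ?_, h⟩ h2
    rw [Finsupp.smul_apply, smul_eq_mul]
    exact ((mem_posSupport.mp (hf.mem_posSupport_iff.mpr h)).1 i).mul_left k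

/-- A PN-polynomial in the SAGE cone splits its positive part among its negative terms. -/
lemma IsPNPolynomial.exists_split {n : ℕ} {f : MvPolynomial (Fin n) ℝ} (hf : IsPNPolynomial f)
    (hs : toRatExpPoly f ∈ sageCone n) :
    ∃ (c : (Fin n →₀ ℕ) → (Fin n →₀ ℕ) → ℝ) (e : (Fin n →₀ ℕ) → ℝ),
      (∀ β α, α ∈ posSupport f → β ∈ negSupport f → 0 ≤ c β α) ∧
      (∀ α ∈ posSupport f, 0 ≤ e α) ∧
      (∀ α ∈ posSupport f, f.coeff α = ∑ β ∈ negSupport f, c β α + e α) ∧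
      ∀ β ∈ negSupport f, ∀ y : Fin n → ℝ,
        -f.coeff β * Real.exp (∑ i, (β i : ℝ) * y i) ≤
          ∑ α ∈ posSupport f, c β α * Real.exp (∑ i, (α i : ℝ) * y i) := by
  classical
  obtain ⟨I, g, hI, g1, g2, g3, g4⟩ := exists_isAGE_noncancelling hs
  have hcs : ∀ q, (toRatExpPoly f).coeff q = ∑ i ∈ I, (g i).coeff q := fun q => by
    rw [g2, AddMonoidAlgebra.coeff_sum, Finset.sum_apply']
  have hnegI : ∀ β ∈ negSupport f, ratPoint β ∈ I := fun β hβ => by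
    refine hI (Finsupp.mem_support_iff.mpr ?_)
    rw [coeff_toRatExpPoly]
    exact (hf.mem_negSupport_iff.mp hβ).ne
  have hpos : ∀ α ∈ posSupport f, ∀ i ∈ I, 0 ≤ (g i).coeff (ratPoint α) := fun α hα i hi => by
    refine g4 _ ?_ i hi
    rw [coeff_toRatExpPoly]
    exact (hf.mem_posSupport_iff.mp hα).le
  have hinj : Set.InjOn (ratPoint (n := n)) (negSupport f) := ratPoint_injective.injOn
  have hsub : (negSupport f).image ratPoint ⊆ I := by
    intro q hq
    obtain ⟨β, hβ, rfl⟩ := Finset.mem_image.mp hq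
    exact hnegI β hβ
  -- The summand with index β provides c β; the summands whose index is not in Γ(f) are pooled into
  -- e.
  refine ⟨fun β α => (g (ratPoint β)).coeff (ratPoint α),
    fun α => ∑ i ∈ I \ (negSupport f).image ratPoint, (g i).coeff (ratPoint α), ?_, ?_, ?_, ?_⟩
  · exact fun β α hα hβ => hpos α hα _ (hnegI β hβ)
  · exact fun α hα => Finset.sum_nonneg fun i hi => hpos α hα i (Finset.mem_sdiff.mp hi).1
  · intro α _
    rw [← coeff_toRatExpPoly, hcs, ← Finset.sum_sdiff hsub, Finset.sum_image hinj, add_comm]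
  · intro β hβ y
    -- Off the support of f the coefficients of the summands are nonnegative with sum zero, so no
    -- summand has an exponent outside the support.
    have hzero : ∀ q, (∀ α ∈ f.support, ratPoint α ≠ q) → (g (ratPoint β)).coeff q = 0 := by
      intro q hq
      have h0 := coeff_toRatExpPoly_of_notMem f q hq
      have h1 := hcs q
      rw [h0] at h1
      exact (Finset.sum_eq_zero_iff_of_nonneg (fun i hi => g4 q h0.ge i hi)).mp h1.symm _
        (hnegI β hβ)
    have hβc : (g (ratPoint β)).coeff (ratPoint β) = f.coeff β := by
      rw [← coeff_toRatExpPoly, hcs]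
      refine (Finset.sum_eq_single_of_mem (f := fun i => (g i).coeff (ratPoint β)) _ (hnegI β hβ)
        fun i hi hne => ?_).symm
      refine g3 _ ?_ i hi hne
      rw [coeff_toRatExpPoly]
      exact hf.mem_negSupport_iff.mp hβ
    have hdis : β ∉ posSupport f := fun h => by
      have := hf.mem_posSupport_iff.mp h
      have := hf.mem_negSupport_iff.mp hβ
      linarith
    have hrep : g (ratPoint β) = ratTerm (ratPoint β) (f.coeff β) + ∑ α ∈ posSupport f,
        ratTerm (ratPoint α) ((g (ratPoint β)).coeff (ratPoint α)) := by
      ext q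
      rw [AddMonoidAlgebra.coeff_add, Finsupp.add_apply, AddMonoidAlgebra.coeff_sum,
        Finset.sum_apply']
      simp only [coeff_ratTerm]
      by_cases hq : ∃ α ∈ f.support, ratPoint α = q
      · obtain ⟨α, hα, rfl⟩ := hq
        simp only [ratPoint_injective.eq_iff, Finset.sum_ite_eq']
        by_cases hαβ : β = α
        · subst hαβ
          simp [hdis, hβc]
        · rw [if_neg hαβ, zero_add]
          split_ifs with hp
          · rfl
          · have hn : f.coeff α < 0 := lt_of_le_of_ne
              (not_lt.mp fun h => hp (hf.mem_posSupport_iff.mpr h))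
              (MvPolynomial.mem_support_iff.mp hα)
            refine g3 _ (by rwa [coeff_toRatExpPoly]) _ (hnegI β hβ) ?_
            exact ratPoint_injective.ne hαβ
      · push Not at hq
        rw [hzero q hq, if_neg, zero_add]
        · refine (Finset.sum_eq_zero fun α hα => if_neg (hq α ?_)).symm
          exact MvPolynomial.mem_support_iff.mpr (hf.mem_posSupport_iff.mp hα).ne'
        · exact hq β (MvPolynomial.mem_support_iff.mpr (hf.mem_negSupport_iff.mp hβ).ne)
    have hev := (g1 _ (hnegI β hβ)).2 y
    rw [hrep, map_add, map_sum] at hev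
    simp only [expEval_ratTerm, ratPoint, Rat.cast_natCast] at hev ⊢
    linarith

/-! ### Entropy certificates for sums of exponentials -/

/-- A sum of exponentials may approach its infimum only at infinity; the quadratic penalty makes it
coercive, so a minimizer exists. The first bound is comparison with y = 0, the second is the
vanishing of the gradient. -/
lemma exists_regularized_minimizer {ι : Type*} [Fintype ι] {n : ℕ} (z : ι → Fin n → ℝ)
    (c : ι → ℝ) (hc : ∀ a, 0 ≤ c a) {ε : ℝ} (hε : 0 < ε) :
    ∃ y : Fin n → ℝ,
      (∑ a, c a * Real.exp (∑ i, z a i * y i) + ε * ∑ i, y i ^ 2 ≤ ∑ a, c a) ∧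
      ∀ i, ∑ a, c a * Real.exp (∑ j, z a j * y j) * z a i + 2 * ε * y i = 0 := by
  classical
  set Φ : (Fin n → ℝ) → ℝ :=
    fun y => ∑ a, c a * Real.exp (∑ i, z a i * y i) + ε * ∑ i, y i ^ 2 with hΦ
  have hcont : Continuous Φ := by fun_prop
  have hlim : Filter.Tendsto Φ (Filter.cocompact _) Filter.atTop := by
    have h1 : Filter.Tendsto (fun y : Fin n → ℝ => ε * ‖y‖ ^ 2) (Filter.cocompact _)
        Filter.atTop :=
      ((Filter.tendsto_pow_atTop two_ne_zero).comp
        (tendsto_norm_cocompact_atTop (E := Fin n → ℝ))).const_mul_atTop hε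
    refine Filter.tendsto_atTop_mono (fun y => ?_) h1
    have hsq : 0 ≤ ∑ i, y i ^ 2 := Finset.sum_nonneg fun i _ => sq_nonneg _
    have hn : ‖y‖ ≤ Real.sqrt (∑ i, y i ^ 2) := by
      refine (pi_norm_le_iff_of_nonneg (Real.sqrt_nonneg _)).mpr fun i => ?_
      rw [Real.norm_eq_abs]
      refine Real.abs_le_sqrt ?_
      exact Finset.single_le_sum (f := fun i => y i ^ 2) (fun i _ => sq_nonneg _)
        (Finset.mem_univ i)
    have hn2 : ‖y‖ ^ 2 ≤ ∑ i, y i ^ 2 := by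
      rw [← Real.sq_sqrt hsq]
      exact pow_le_pow_left₀ (norm_nonneg _) hn 2
    have hs : 0 ≤ ∑ a, c a * Real.exp (∑ i, z a i * y i) :=
      Finset.sum_nonneg fun a _ => mul_nonneg (hc a) (Real.exp_nonneg _)
    have := mul_le_mul_of_nonneg_left hn2 hε.le
    simp only [hΦ]
    linarith
  obtain ⟨y, hy⟩ := hcont.exists_forall_le hlim
  refine ⟨y, by simpa [hΦ] using hy 0, fun i => ?_⟩
  -- The restriction of Φ to the line through y in direction i, with the square expanded, so that a
  -- one-variable derivative suffices.
  set g : ℝ → ℝ := fun t => ∑ a, c a * Real.exp (∑ j, z a j * y j + t * z a i)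
    + ε * (∑ j, y j ^ 2 + 2 * y i * t + t ^ 2) with hg
  have hgΦ : ∀ t, g t = Φ (y + Pi.single i t) := by
    intro t
    simp only [hg, hΦ, Pi.add_apply]
    congr 1
    · refine Finset.sum_congr rfl fun a _ => ?_
      congr 2
      simp only [mul_add, Finset.sum_add_distrib, Pi.single_apply, mul_ite, mul_zero,
        Finset.sum_ite_eq', Finset.mem_univ, if_true]
      ring
    · congr 1
      simp only [add_sq, Finset.sum_add_distrib, Pi.single_apply, mul_ite, mul_zero, ite_pow,
        Finset.sum_ite_eq', Finset.mem_univ, if_true, ne_eq, OfNat.ofNat_ne_zero,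
        not_false_eq_true, zero_pow]
  have hmin : IsLocalMin g 0 := by
    refine Filter.Eventually.of_forall fun t => ?_
    rw [hgΦ, hgΦ, Pi.single_zero, add_zero]
    exact hy _
  have hder : HasDerivAt g (∑ a, c a * (Real.exp (∑ j, z a j * y j + 0 * z a i) * (1 * z a i))
      + ε * ((2 * y i * 1) + (2 : ℕ) * (0 : ℝ) ^ (2 - 1))) 0 := by
    refine HasDerivAt.add (HasDerivAt.fun_sum fun a _ => ?_) ?_
    · refine HasDerivAt.const_mul _ (HasDerivAt.exp ?_)
      exact ((hasDerivAt_id' (0 : ℝ)).mul_const _).const_add _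
    · refine HasDerivAt.const_mul _ (HasDerivAt.add ?_ (hasDerivAt_pow 2 (0 : ℝ)))
      exact ((hasDerivAt_id' (0 : ℝ)).const_mul _).const_add _
  have h0 := hmin.hasDerivAt_eq_zero hder
  rw [← h0]
  congr 1
  · exact Finset.sum_congr rfl fun a _ => by rw [zero_mul, add_zero, one_mul, mul_assoc]
  · norm_num
    ring

/-- A lower bound for a sum of exponentials has a certificate by relative entropy. -/
lemma exists_entropy_certificate {ι : Type*} [Fintype ι] {n : ℕ} (z : ι → Fin n → ℝ)
    (c : ι → ℝ) (hc : ∀ a, 0 ≤ c a) {d : ℝ}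
    (h : ∀ y : Fin n → ℝ, d ≤ ∑ a, c a * Real.exp (∑ i, z a i * y i)) :
    ∃ ν : ι → ℝ, (∀ a, 0 ≤ ν a) ∧ (∀ a, c a = 0 → ν a = 0) ∧ (∀ i, ∑ a, ν a * z a i = 0) ∧
      d ≤ ∑ a, ν a ∧ ∑ a, (ν a * Real.log (ν a) - ν a * Real.log (c a)) ≤ 0 := by
  set B := ∑ a, c a with hB
  have hB0 : 0 ≤ B := Finset.sum_nonneg fun a _ => hc a
  -- K imposes every requirement except the balance ∑ ν z = 0, which regularized minimizers satisfy
  -- only up to O(ε). By compactness the defect attains its minimum on K, and that minimum is zero.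
  set K : Set (ι → ℝ) := {ν | (∀ a, ν a ∈ Set.Icc 0 B) ∧ (∀ a, c a = 0 → ν a = 0) ∧
    d ≤ ∑ a, ν a ∧ ∑ a, (ν a * Real.log (ν a) - ν a * Real.log (c a)) ≤ 0} with hK
  have happrox : ∀ ε > 0, ∃ ν ∈ K, ∑ i, (∑ a, ν a * z a i) ^ 2 ≤ 4 * ε * B := by
    intro ε hε
    obtain ⟨y, hy1, hy2⟩ := exists_regularized_minimizer z c hc hε
    have hpos : ∀ a, 0 ≤ c a * Real.exp (∑ i, z a i * y i) :=
      fun a => mul_nonneg (hc a) (Real.exp_nonneg _)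
    have hsq : 0 ≤ ε * ∑ i, y i ^ 2 :=
      mul_nonneg hε.le (Finset.sum_nonneg fun i _ => sq_nonneg _)
    have hgrad : ∀ i, ∑ a, c a * Real.exp (∑ j, z a j * y j) * z a i = -(2 * ε * y i) :=
      fun i => by linarith [hy2 i]
    refine ⟨fun a => c a * Real.exp (∑ i, z a i * y i), ⟨fun a => ⟨hpos a, ?_⟩, fun a ha => ?_,
      h y, ?_⟩, ?_⟩
    · have := Finset.single_le_sum (fun a _ => hpos a) (Finset.mem_univ a)
      exact this.trans (by linarith)
    · simp [ha]
    -- Where c > 0, log ν - log c is the linear form z·y. Hence the entropy is the gradient paired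
    -- with y, which stationarity turns into -2ε|y|².
    · have hterm : ∀ a, c a * Real.exp (∑ i, z a i * y i)
            * Real.log (c a * Real.exp (∑ i, z a i * y i))
          - c a * Real.exp (∑ i, z a i * y i) * Real.log (c a)
          = ∑ i, c a * Real.exp (∑ j, z a j * y j) * z a i * y i := by
        intro a
        rcases (hc a).eq_or_lt with h0 | h0
        · simp [← h0]
        · rw [Real.log_mul h0.ne' (Real.exp_pos _).ne', Real.log_exp, mul_add, add_sub_cancel_left,
            Finset.mul_sum]
          exact Finset.sum_congr rfl fun i _ => by ring
      rw [Finset.sum_congr rfl fun a _ => hterm a, Finset.sum_comm]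
      simp only [← Finset.sum_mul, hgrad]
      refine Finset.sum_nonpos fun i _ => ?_
      have := mul_nonneg hε.le (sq_nonneg (y i))
      nlinarith
    -- The squared gradient is 4ε·(ε|y|²), and ε|y|² ≤ B by comparison with y = 0.
    · simp only [hgrad]
      have : ∑ i, (-(2 * ε * y i)) ^ 2 = 4 * ε * (ε * ∑ i, y i ^ 2) := by
        rw [Finset.mul_sum, Finset.mul_sum]
        exact Finset.sum_congr rfl fun i _ => by ring
      rw [this]
      refine mul_le_mul_of_nonneg_left ?_ (by positivity)
      have := Finset.sum_nonneg fun a (_ : a ∈ Finset.univ) => hpos a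
      linarith
  have hcompact : IsCompact K := by
    have h1 : IsClosed {ν : ι → ℝ | ∀ a, c a = 0 → ν a = 0} := by
      simp only [Set.ofPred_forall]
      exact isClosed_iInter fun a => isClosed_iInter fun _ =>
        isClosed_eq (continuous_apply a) continuous_const
    have h2 : IsClosed {ν : ι → ℝ | d ≤ ∑ a, ν a} :=
      isClosed_le continuous_const (continuous_finsetSum _ fun a _ => continuous_apply a)
    have h3 : IsClosed {ν : ι → ℝ |
        ∑ a, (ν a * Real.log (ν a) - ν a * Real.log (c a)) ≤ 0} := by
      refine isClosed_le (continuous_finsetSum _ fun a _ => ?_) continuous_const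
      exact (Real.continuous_mul_log.comp (continuous_apply a)).sub
        ((continuous_apply a).mul continuous_const)
    have hsub : K = (Set.univ.pi fun _ => Set.Icc 0 B) ∩ ({ν : ι → ℝ | ∀ a, c a = 0 → ν a = 0} ∩
        ({ν : ι → ℝ | d ≤ ∑ a, ν a} ∩
          {ν : ι → ℝ | ∑ a, (ν a * Real.log (ν a) - ν a * Real.log (c a)) ≤ 0})) := by
      ext ν
      simp only [hK, Set.mem_inter_iff, Set.mem_univ_pi]
      rfl
    rw [hsub]
    exact (isCompact_univ_pi fun _ => isCompact_Icc).inter_right (h1.inter (h2.inter h3))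
  obtain ⟨ν₁, hν₁, -⟩ := happrox 1 one_pos
  have hF : Continuous fun ν : ι → ℝ => ∑ i, (∑ a, ν a * z a i) ^ 2 := by fun_prop
  obtain ⟨ν, hν, hmin⟩ := hcompact.exists_isMinOn ⟨ν₁, hν₁⟩ hF.continuousOn
  have hle : ∑ i, (∑ a, ν a * z a i) ^ 2 ≤ 0 := by
    refine le_of_forall_pos_le_add fun δ hδ => ?_
    obtain ⟨ν', hν', hle⟩ := happrox (δ / (4 * (B + 1))) (by positivity)
    refine (hmin hν').trans (hle.trans ?_)
    have : 4 * (δ / (4 * (B + 1))) * B = δ * (B / (B + 1)) := by field_simp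
    rw [this, zero_add]
    exact mul_le_of_le_one_right hδ.le ((div_le_one (by positivity)).mpr (by linarith))
  have hzero := (Finset.sum_eq_zero_iff_of_nonneg fun i _ => sq_nonneg _).mp
    (le_antisymm hle (Finset.sum_nonneg fun i _ => sq_nonneg (∑ a, ν a * z a i)))
  exact ⟨ν, fun a => (hν.1 a).1, hν.2.1,
    fun i => pow_eq_zero_iff two_ne_zero |>.mp (hzero i (Finset.mem_univ i)), hν.2.2.1, hν.2.2.2⟩

/-! ### Decomposition of AGE polynomials into circuits -/

/-- The cone generated by the circuit polynomials with inner exponent `β` and outer exponents in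
`S` that are nonnegative on the positive orthant. -/
def circuitCone {n : ℕ} (S : Finset (Fin n →₀ ℕ)) (β : Fin n →₀ ℕ) :
    AddSubmonoid (MvPolynomial (Fin n) ℝ) :=
  AddSubmonoid.closure {p | ∃ T ⊆ S, IsCircuit T β ∧ ∃ (c : (Fin n →₀ ℕ) → ℝ) (d : ℝ),
    (∀ α ∈ T, 0 < c α) ∧ 0 ≤ d ∧
    (∀ y : Fin n → ℝ, d * Real.exp (∑ i, (β i : ℝ) * y i) ≤
      ∑ α ∈ T, c α * Real.exp (∑ i, (α i : ℝ) * y i)) ∧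
    p = ∑ α ∈ T, MvPolynomial.monomial α (c α) - MvPolynomial.monomial β d}

/-- The cone of polynomials with nonnegative coefficients and support in `S`. -/
def posyCone {n : ℕ} (S : Finset (Fin n →₀ ℕ)) : AddSubmonoid (MvPolynomial (Fin n) ℝ) :=
  AddSubmonoid.closure {p | ∃ α ∈ S, ∃ e : ℝ, 0 ≤ e ∧ p = MvPolynomial.monomial α e}

lemma sum_monomial_mem_posyCone {n : ℕ} {S T : Finset (Fin n →₀ ℕ)} (hT : T ⊆ S)
    {e : (Fin n →₀ ℕ) → ℝ} (he : ∀ α ∈ T, 0 ≤ e α) :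
    ∑ α ∈ T, MvPolynomial.monomial α (e α) ∈ posyCone S :=
  sum_mem fun α hα => AddSubmonoid.subset_closure ⟨α, hT hα, _, he α hα, rfl⟩

lemma eq_sum_of_mem_posyCone {n : ℕ} {S : Finset (Fin n →₀ ℕ)} {p : MvPolynomial (Fin n) ℝ}
    (hp : p ∈ posyCone S) :
    ∃ e : (Fin n →₀ ℕ) → ℝ, (∀ α, 0 ≤ e α) ∧ p = ∑ α ∈ S, MvPolynomial.monomial α (e α) := by
  classical
  induction hp using AddSubmonoid.closure_induction with
  | mem p hp =>
    obtain ⟨α, hα, e, he, rfl⟩ := hp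
    refine ⟨fun γ => if γ = α then e else 0, fun γ => by positivity, ?_⟩
    rw [Finset.sum_eq_single_of_mem α hα]
    · simp
    · intro γ _ hγ
      simp [hγ]
  | zero => exact ⟨0, fun _ => le_rfl, by simp⟩
  | add p q _ _ hp hq =>
    obtain ⟨e, he, rfl⟩ := hp
    obtain ⟨e', he', rfl⟩ := hq
    exact ⟨e + e', fun α => add_nonneg (he α) (he' α), by simp [Finset.sum_add_distrib]⟩

/-- Carathéodory: a positive combination of points of `S` representing `β` has in its support the
vertices of a simplex with `β` in its relative interior. -/
lemma exists_isCircuit_subset {n : ℕ} {S : Finset (Fin n →₀ ℕ)} {β : Fin n →₀ ℕ}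
    (heven : ∀ α ∈ S, ∀ i, Even (α i)) (hS : S.Nonempty) {ν : (Fin n →₀ ℕ) → ℝ}
    (hν : ∀ α ∈ S, 0 < ν α) (hβ : ∀ i, ∑ α ∈ S, ν α * ((α i : ℝ) - β i) = 0) :
    ∃ T ⊆ S, IsCircuit T β := by
  classical
  set P : (Fin n →₀ ℕ) → Fin n → ℝ := fun α i => (α i : ℝ) with hP
  have hpos : 0 < ∑ α ∈ S, ν α := Finset.sum_pos hν hS
  have hmem : P β ∈ convexHull ℝ (P '' S) := by
    have h := Finset.centerMass_mem_convexHull (R := ℝ) S (fun α hα => (hν α hα).le) hpos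
      (fun α hα => Set.mem_image_of_mem P (Finset.mem_coe.mpr hα))
    convert h
    rw [Finset.centerMass, eq_inv_smul_iff₀ hpos.ne']
    ext i
    have := hβ i
    simp only [mul_sub, Finset.sum_sub_distrib, ← Finset.sum_mul] at this
    simp only [Pi.smul_apply, Finset.sum_apply, smul_eq_mul, hP]
    linarith
  obtain ⟨ι, _, z, w, hz, hind, hw, hw1, hwβ⟩ := eq_pos_convex_span_of_mem_convexHull hmem
  have hz' : ∀ j, ∃ α ∈ S, P α = z j := fun j => by
    obtain ⟨α, hα, h⟩ := hz (Set.mem_range_self j)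
    exact ⟨α, hα, h⟩
  choose a haS haz using hz'
  have hinj : Function.Injective a := fun j k h => hind.injective (by rw [← haz, ← haz, h])
  set T := Finset.univ.image a with hT
  have hTS : T ⊆ S := by
    intro α hα
    obtain ⟨j, -, rfl⟩ := Finset.mem_image.mp hα
    exact haS j
  have hpre : ∀ α : T, ∃ j, a j = α := fun α => by
    obtain ⟨j, -, h⟩ := Finset.mem_image.mp α.2
    exact ⟨j, h⟩
  choose b hb using hpre
  refine ⟨T, hTS, ⟨fun α hα => heven α (hTS hα), ?_, Function.extend a w 0, ?_, ?_, ?_⟩⟩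
  · have hbinj : Function.Injective b := fun α γ h => Subtype.ext (by rw [← hb, ← hb, h])
    have hzb : (fun (α : T) (i : Fin n) => ((α : Fin n →₀ ℕ) i : ℝ)) = z ∘ b := by
      funext α
      rw [Function.comp_apply, ← haz, hb]
    rw [hzb]
    exact hind.comp_embedding ⟨b, hbinj⟩
  · intro α hα
    obtain ⟨j, -, rfl⟩ := Finset.mem_image.mp hα
    rw [hinj.extend_apply]
    exact hw j
  · rw [Finset.sum_image hinj.injOn]
    simpa only [hinj.extend_apply] using hw1
  · intro i
    rw [Finset.sum_image hinj.injOn]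
    simp only [hinj.extend_apply]
    have := congrFun hwβ i
    simpa [← haz, hP] using this

lemma sum_mul_exp_sub {n : ℕ} (T : Finset (Fin n →₀ ℕ)) (β : Fin n →₀ ℕ)
    (c : (Fin n →₀ ℕ) → ℝ) (y : Fin n → ℝ) :
    ∑ α ∈ T, c α * Real.exp (∑ i, (α i : ℝ) * y i) =
      (∑ α ∈ T, c α * Real.exp (∑ i, ((α i : ℝ) - β i) * y i)) *
        Real.exp (∑ i, (β i : ℝ) * y i) := by
  rw [Finset.sum_mul]
  refine Finset.sum_congr rfl fun α _ => ?_
  rw [mul_assoc, ← Real.exp_add, ← Finset.sum_add_distrib]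
  simp only [sub_mul, sub_add_cancel]

/-- The tangent-line bound for a balanced sum of exponentials. -/
lemma entropy_bound {n : ℕ} {T : Finset (Fin n →₀ ℕ)} {β : Fin n →₀ ℕ} {l : (Fin n →₀ ℕ) → ℝ}
    (hl : ∀ α ∈ T, 0 ≤ l α) (hβ : ∀ i, ∑ α ∈ T, l α * ((α i : ℝ) - β i) = 0)
    (r : (Fin n →₀ ℕ) → ℝ) (y : Fin n → ℝ) :
    (∑ α ∈ T, l α * (1 - r α)) * Real.exp (∑ i, (β i : ℝ) * y i) ≤
      ∑ α ∈ T, l α * Real.exp (-r α) * Real.exp (∑ i, (α i : ℝ) * y i) := by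
  rw [sum_mul_exp_sub T β]
  refine mul_le_mul_of_nonneg_right ?_ (Real.exp_nonneg _)
  have h0 : ∑ α ∈ T, l α * ∑ i, ((α i : ℝ) - β i) * y i = 0 := by
    simp only [Finset.mul_sum]
    rw [Finset.sum_comm]
    refine Finset.sum_eq_zero fun i _ => ?_
    rw [← zero_mul (y i), ← hβ i, Finset.sum_mul]
    exact Finset.sum_congr rfl fun α _ => by ring
  calc ∑ α ∈ T, l α * (1 - r α)
      = ∑ α ∈ T, l α * (1 - r α) + ∑ α ∈ T, l α * ∑ i, ((α i : ℝ) - β i) * y i := by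
        rw [h0, add_zero]
    _ = ∑ α ∈ T, l α * (-r α + ∑ i, ((α i : ℝ) - β i) * y i + 1) := by
        rw [← Finset.sum_add_distrib]
        exact Finset.sum_congr rfl fun α _ => by ring
    _ ≤ _ := Finset.sum_le_sum fun α hα => by
        rw [mul_assoc, ← Real.exp_add]
        exact mul_le_mul_of_nonneg_left (Real.add_one_le_exp _) (hl α hα)

/-- Subtract from ν the largest multiple of the barycentric weights of some circuit in its support
that leaves it nonnegative. The remainder is again balanced and has smaller support, so induction
applies. The factors exp(-r α) are carried along unchanged, so `entropy_bound` controls every piece;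
the alternative d = 0 covers pieces whose bound is negative. -/
lemma mem_circuitCone_sup_posyCone_of_balanced {n : ℕ} {A : Finset (Fin n →₀ ℕ)}
    {β : Fin n →₀ ℕ} (heven : ∀ α ∈ A, ∀ i, Even (α i)) (r : (Fin n →₀ ℕ) → ℝ)
    (S : Finset (Fin n →₀ ℕ)) :
    ∀ (_ : S ⊆ A) (ν : (Fin n →₀ ℕ) → ℝ) (_ : ∀ α ∈ S, 0 < ν α)
      (_ : ∀ i, ∑ α ∈ S, ν α * ((α i : ℝ) - β i) = 0) (d : ℝ) (_ : 0 ≤ d)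
      (_ : d = 0 ∨ d ≤ ∑ α ∈ S, ν α * (1 - r α)),
      ∑ α ∈ S, MvPolynomial.monomial α (ν α * Real.exp (-r α)) - MvPolynomial.monomial β d
        ∈ circuitCone A β ⊔ posyCone A := by
  classical
  induction S using Finset.strongInduction with
  | H S ih =>
    intro hSA ν hν hβ d hd hdX
    have hposy : ∑ α ∈ S, MvPolynomial.monomial α (ν α * Real.exp (-r α))
        ∈ circuitCone A β ⊔ posyCone A :=
      (le_sup_right : posyCone A ≤ _) (sum_monomial_mem_posyCone hSA fun α hα =>
        mul_nonneg (hν α hα).le (Real.exp_nonneg _))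
    rcases hdX with rfl | hdX
    · simpa using hposy
    rcases S.eq_empty_or_nonempty with rfl | hne
    · have : d = 0 := le_antisymm (by simpa using hdX) hd
      simp [this]
    obtain ⟨T, hTS, hT⟩ := exists_isCircuit_subset (fun α hα => heven α (hSA hα)) hne hν hβ
    obtain ⟨l, hl, hl1, hlβ⟩ := hT.mem_interior
    have hTne : T.Nonempty := by
      by_contra h
      rw [Finset.not_nonempty_iff_eq_empty] at h
      simp [h] at hl1
    have hlβ' : ∀ i, ∑ α ∈ T, l α * ((α i : ℝ) - β i) = 0 := fun i => by
      simp only [mul_sub, Finset.sum_sub_distrib, ← Finset.sum_mul, hlβ, hl1, one_mul, sub_self]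
    -- The minimal ratio is the largest admissible multiple, and α₀ leaves the support.
    obtain ⟨α₀, hα₀, hmin⟩ := T.exists_min_image (fun α => ν α / l α) hTne
    set t := ν α₀ / l α₀ with ht
    have htpos : 0 < t := div_pos (hν _ (hTS hα₀)) (hl _ hα₀)
    set m : (Fin n →₀ ℕ) → ℝ := fun α => if α ∈ T then t * l α else 0 with hm
    have hmT : ∀ α ∈ T, m α = t * l α := fun α hα => if_pos hα
    have hmle : ∀ α ∈ S, 0 ≤ ν α - m α := by
      intro α hα
      by_cases h : α ∈ T
      · rw [hmT α h, sub_nonneg]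
        exact (le_div_iff₀ (hl α h)).mp (hmin α h)
      · simp only [hm, if_neg h, sub_zero]
        exact (hν α hα).le
    set S' := S.filter (fun α => 0 < ν α - m α) with hS'
    have hS'S : S' ⊆ S := Finset.filter_subset _ _
    have hssub : S' ⊂ S := by
      refine Finset.ssubset_iff_subset_ne.mpr ⟨hS'S, fun h => ?_⟩
      have : α₀ ∈ S' := h ▸ hTS hα₀
      have h2 := (Finset.mem_filter.mp this).2
      rw [hmT α₀ hα₀, ht, div_mul_cancel₀ _ (hl α₀ hα₀).ne', sub_self] at h2
      exact lt_irrefl _ h2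
    have hzero : ∀ α ∈ S, α ∉ S' → ν α - m α = 0 := fun α hα h =>
      le_antisymm (not_lt.mp fun h' => h (Finset.mem_filter.mpr ⟨hα, h'⟩)) (hmle α hα)
    have hsplit : ∀ g : (Fin n →₀ ℕ) → ℝ, ∑ α ∈ S, ν α * g α =
        ∑ α ∈ T, t * l α * g α + ∑ α ∈ S', (ν α - m α) * g α := by
      intro g
      have e1 : ∑ α ∈ T, t * l α * g α = ∑ α ∈ S, m α * g α := by
        rw [← Finset.sum_subset hTS fun α _ h => by simp only [hm, if_neg h, zero_mul]]
        exact Finset.sum_congr rfl fun α hα => by rw [hmT α hα]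
      rw [e1, Finset.sum_subset hS'S fun α hα h => by rw [hzero α hα h, zero_mul],
        ← Finset.sum_add_distrib]
      exact Finset.sum_congr rfl fun α _ => by ring
    have hsplit' : ∑ α ∈ S, MvPolynomial.monomial α (ν α * Real.exp (-r α)) =
        ∑ α ∈ T, MvPolynomial.monomial α (t * l α * Real.exp (-r α)) +
        ∑ α ∈ S', MvPolynomial.monomial α ((ν α - m α) * Real.exp (-r α)) := by
      have e1 : ∑ α ∈ T, MvPolynomial.monomial α (t * l α * Real.exp (-r α)) =
          ∑ α ∈ S, MvPolynomial.monomial α (m α * Real.exp (-r α)) := by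
        rw [← Finset.sum_subset hTS fun α _ h => by
          simp only [hm, if_neg h, zero_mul, map_zero]]
        exact Finset.sum_congr rfl fun α hα => by rw [hmT α hα]
      rw [e1, Finset.sum_subset hS'S fun α hα h => by rw [hzero α hα h, zero_mul, map_zero],
        ← Finset.sum_add_distrib]
      refine Finset.sum_congr rfl fun α _ => ?_
      rw [← map_add]
      congr 1
      ring
    have htβ : ∀ i, ∑ α ∈ T, t * l α * ((α i : ℝ) - β i) = 0 := fun i => by
      rw [← mul_zero t, ← hlβ' i, Finset.mul_sum]
      exact Finset.sum_congr rfl fun α _ => by ring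
    have hβ' : ∀ i, ∑ α ∈ S', (ν α - m α) * ((α i : ℝ) - β i) = 0 := fun i => by
      have := hsplit fun α => (α i : ℝ) - β i
      rw [hβ i, htβ i, zero_add] at this
      exact this.symm
    -- The share d₁ of the peeled circuit is its bound X₁ clamped to [0, d].
    obtain ⟨d₁, d₂, hd₁, hd₂, hdd, h₁, h₂⟩ : ∃ d₁ d₂ : ℝ, 0 ≤ d₁ ∧ 0 ≤ d₂ ∧ d = d₁ + d₂ ∧
        (d₁ = 0 ∨ d₁ ≤ ∑ α ∈ T, t * l α * (1 - r α)) ∧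
        (d₂ = 0 ∨ d₂ ≤ ∑ α ∈ S', (ν α - m α) * (1 - r α)) := by
      rw [hsplit fun α => 1 - r α] at hdX
      set X₁ := ∑ α ∈ T, t * l α * (1 - r α)
      rcases le_total X₁ 0 with h | h
      · exact ⟨0, d, le_rfl, hd, by ring, Or.inl rfl, Or.inr (by linarith)⟩
      · rcases le_total X₁ d with h' | h'
        · exact ⟨X₁, d - X₁, h, by linarith, by ring, Or.inr le_rfl, Or.inr (by linarith)⟩
        · exact ⟨d, 0, hd, le_rfl, by ring, Or.inr h', Or.inl rfl⟩
    have hcirc : ∑ α ∈ T, MvPolynomial.monomial α (t * l α * Real.exp (-r α))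
        - MvPolynomial.monomial β d₁ ∈ circuitCone A β := by
      have htl : ∀ α ∈ T, 0 < t * l α := fun α hα => mul_pos htpos (hl α hα)
      refine AddSubmonoid.subset_closure ⟨T, hTS.trans hSA, hT,
        fun α => t * l α * Real.exp (-r α), d₁,
        fun α hα => mul_pos (htl α hα) (Real.exp_pos _), hd₁, fun y => ?_, rfl⟩
      rcases h₁ with h₁ | h₁
      · rw [h₁, zero_mul]
        exact Finset.sum_nonneg fun α hα =>
          mul_nonneg (mul_nonneg (htl α hα).le (Real.exp_nonneg _)) (Real.exp_nonneg _)
      · exact (mul_le_mul_of_nonneg_right h₁ (Real.exp_nonneg _)).trans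
          (entropy_bound (fun α hα => (htl α hα).le) htβ r y)
    have hrest := ih S' hssub (hS'S.trans hSA) (fun α => ν α - m α)
      (fun α hα => (Finset.mem_filter.mp hα).2) hβ' d₂ hd₂ h₂
    have heq : ∑ α ∈ S, MvPolynomial.monomial α (ν α * Real.exp (-r α))
        - MvPolynomial.monomial β d =
        (∑ α ∈ T, MvPolynomial.monomial α (t * l α * Real.exp (-r α))
          - MvPolynomial.monomial β d₁) +
        (∑ α ∈ S', MvPolynomial.monomial α ((ν α - m α) * Real.exp (-r α))
          - MvPolynomial.monomial β d₂) := by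
      rw [hsplit', hdd, map_add]
      ring
    rw [heq]
    exact add_mem ((le_sup_left : circuitCone A β ≤ _) hcirc) hrest

/-- A polynomial with one negative term that is nonnegative on the positive orthant is a sum of
nonnegative circuits and of monomials with nonnegative coefficients. -/
lemma mem_circuitCone_sup_posyCone {n : ℕ} {A : Finset (Fin n →₀ ℕ)} {β : Fin n →₀ ℕ}
    (heven : ∀ α ∈ A, ∀ i, Even (α i)) {c : (Fin n →₀ ℕ) → ℝ} (hc : ∀ α ∈ A, 0 ≤ c α) {d : ℝ}
    (hd : 0 ≤ d) (h : ∀ y : Fin n → ℝ, d * Real.exp (∑ i, (β i : ℝ) * y i) ≤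
      ∑ α ∈ A, c α * Real.exp (∑ i, (α i : ℝ) * y i)) :
    ∑ α ∈ A, MvPolynomial.monomial α (c α) - MvPolynomial.monomial β d
      ∈ circuitCone A β ⊔ posyCone A := by
  classical
  obtain ⟨ν₀, h1, h2, h3, h4, h5⟩ := exists_entropy_certificate
    (fun (α : A) i => ((α : Fin n →₀ ℕ) i : ℝ) - β i) (fun α => c α) (fun α => hc α α.2) (d := d)
    (fun y => by
      have := h y
      rw [sum_mul_exp_sub A β] at this
      rw [Finset.sum_coe_sort A fun α => c α * Real.exp (∑ i, ((α i : ℝ) - β i) * y i)]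
      exact le_of_mul_le_mul_right this (Real.exp_pos _))
  obtain ⟨ν, hν⟩ : ∃ ν : (Fin n →₀ ℕ) → ℝ, ∀ α : A, ν₀ α = ν α :=
    ⟨fun α => if hα : α ∈ A then ν₀ ⟨α, hα⟩ else 0, fun α => by simp⟩
  simp only [hν] at h1 h2 h3 h4 h5
  rw [Finset.sum_coe_sort A ν] at h4
  rw [Finset.sum_coe_sort A fun α => ν α * Real.log (ν α) - ν α * Real.log (c α)] at h5
  replace h3 : ∀ i, ∑ α ∈ A, ν α * ((α i : ℝ) - β i) = 0 := fun i => by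
    rw [← Finset.sum_coe_sort A fun α => ν α * ((α i : ℝ) - β i)]
    exact h3 i
  set S := A.filter (fun α => 0 < ν α) with hS
  have hSA : S ⊆ A := Finset.filter_subset _ _
  have hS0 : ∀ α ∈ A, α ∉ S → ν α = 0 := fun α hα hαS =>
    le_antisymm (not_lt.mp fun h' => hαS (Finset.mem_filter.mpr ⟨hα, h'⟩)) (h1 ⟨α, hα⟩)
  have hSpos : ∀ α ∈ S, 0 < ν α := fun α hα => (Finset.mem_filter.mp hα).2
  have hcpos : ∀ α ∈ S, 0 < c α := fun α hα =>
    lt_of_le_of_ne (hc α (hSA hα)) fun h0 =>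
      (hSpos α hα).ne' (h2 ⟨α, hSA hα⟩ h0.symm)
  -- With this r, c = ν exp(-r) on S, and ∑ ν (1 - r) is the mass of ν minus its relative entropy,
  -- hence at least d.
  set r : (Fin n →₀ ℕ) → ℝ := fun α => Real.log (ν α) - Real.log (c α) with hr
  have hcr : ∀ α ∈ S, ν α * Real.exp (-r α) = c α := fun α hα => by
    rw [hr]
    simp only [neg_sub]
    rw [Real.exp_sub, Real.exp_log (hcpos α hα), Real.exp_log (hSpos α hα),
      mul_div_cancel₀ _ (hSpos α hα).ne']
  have hX : d ≤ ∑ α ∈ S, ν α * (1 - r α) := by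
    rw [Finset.sum_subset hSA fun α hα h' => by rw [hS0 α hα h', zero_mul]]
    have : ∑ α ∈ A, ν α * (1 - r α) = ∑ α ∈ A, ν α
        - ∑ α ∈ A, (ν α * Real.log (ν α) - ν α * Real.log (c α)) := by
      rw [← Finset.sum_sub_distrib]
      exact Finset.sum_congr rfl fun α _ => by simp only [hr]; ring
    rw [this]
    linarith
  have hβS : ∀ i, ∑ α ∈ S, ν α * ((α i : ℝ) - β i) = 0 := fun i => by
    rw [Finset.sum_subset hSA fun α hα h' => by rw [hS0 α hα h', zero_mul], h3 i]
  have hmain := mem_circuitCone_sup_posyCone_of_balanced heven r S hSA ν hSpos hβS d hd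
    (Or.inr hX)
  rw [Finset.sum_congr rfl fun α hα => by rw [hcr α hα]] at hmain
  have hrest : ∑ α ∈ A \ S, MvPolynomial.monomial α (c α) ∈ posyCone A :=
    sum_monomial_mem_posyCone Finset.sdiff_subset fun α hα =>
      hc α (Finset.mem_sdiff.mp hα).1
  rw [← Finset.sum_sdiff hSA, add_sub_assoc]
  exact add_mem ((le_sup_right : posyCone A ≤ _) hrest) hmain

/-- A PN-polynomial in the SAGE cone is a sum of nonnegative circuits on its own support and of
monomials with nonnegative coefficients. -/
lemma IsPNPolynomial.exists_circuit_add {n : ℕ} {f : MvPolynomial (Fin n) ℝ}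
    (hf : IsPNPolynomial f) (hs : toRatExpPoly f ∈ sageCone n) :
    ∃ (p : (Fin n →₀ ℕ) → MvPolynomial (Fin n) ℝ) (e : (Fin n →₀ ℕ) → ℝ),
      (∀ β ∈ negSupport f, p β ∈ circuitCone (posSupport f) β) ∧ (∀ α, 0 ≤ e α) ∧
      f = ∑ β ∈ negSupport f, p β + ∑ α ∈ posSupport f, MvPolynomial.monomial α (e α) := by
  classical
  obtain ⟨c, e, hc, he, hsum, hage⟩ := hf.exists_split hs
  have hdec : ∀ β ∈ negSupport f, ∃ p ∈ circuitCone (posSupport f) β,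
      ∃ q ∈ posyCone (posSupport f), p + q =
        ∑ α ∈ posSupport f, MvPolynomial.monomial α (c β α)
          - MvPolynomial.monomial β (-f.coeff β) := fun β hβ =>
    AddSubmonoid.mem_sup.mp (mem_circuitCone_sup_posyCone
      (fun α hα => (mem_posSupport.mp hα).1) (fun α hα => hc β α hα hβ) (hf β hβ).le (hage β hβ))
  choose! p hp q hq hpq using hdec
  have hf' : f = ∑ β ∈ negSupport f, (∑ α ∈ posSupport f, MvPolynomial.monomial α (c β α)
      - MvPolynomial.monomial β (-f.coeff β))
      + ∑ α ∈ posSupport f, MvPolynomial.monomial α (e α) := by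
    have hsub : posSupport f ⊆ f.support := Finset.filter_subset _ _
    conv_lhs => rw [f.as_sum, ← Finset.sum_sdiff hsub]
    -- `negSupport f` unfolds to the difference produced by `Finset.sum_sdiff`.
    change ∑ β ∈ negSupport f, _ + _ = _
    rw [Finset.sum_sub_distrib, Finset.sum_comm,
      Finset.sum_congr (s₁ := posSupport f) rfl fun α hα => by rw [hsum α hα]]
    simp only [map_add, map_sum, map_neg, Finset.sum_neg_distrib, Finset.sum_add_distrib]
    ring
  have hposy : ∑ β ∈ negSupport f, q β + ∑ α ∈ posSupport f, MvPolynomial.monomial α (e α)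
      ∈ posyCone (posSupport f) :=
    add_mem (sum_mem hq) (sum_monomial_mem_posyCone subset_rfl he)
  obtain ⟨e', he', heq⟩ := eq_sum_of_mem_posyCone hposy
  refine ⟨p, e', hp, he', ?_⟩
  rw [← heq, ← add_assoc, ← Finset.sum_add_distrib, Finset.sum_congr rfl hpq]
  exact hf'

/-! ### SONC polynomials and the SAGE cone -/

lemma isSONC_zero {n : ℕ} : IsSONC (0 : MvPolynomial (Fin n) ℝ) :=
  ⟨0, fun _ => 0, fun j => j.elim0, by simp⟩

lemma IsNonnegCircuit.isSONC {n : ℕ} {p : MvPolynomial (Fin n) ℝ} (hp : IsNonnegCircuit p) :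
    IsSONC p := ⟨1, fun _ => p, fun _ => hp, by simp⟩

lemma IsSONC.add {n : ℕ} {p q : MvPolynomial (Fin n) ℝ} (hp : IsSONC p) (hq : IsSONC q) :
    IsSONC (p + q) := by
  obtain ⟨N, g, hg, rfl⟩ := hp
  obtain ⟨N', g', hg', rfl⟩ := hq
  refine ⟨N + N', Fin.append g g', fun j => ?_, ?_⟩
  · refine Fin.addCases (fun i => ?_) (fun i => ?_) j
    · rw [Fin.append_left]; exact hg i
    · rw [Fin.append_right]; exact hg' i
  · rw [Fin.sum_univ_add]
    simp only [Fin.append_left, Fin.append_right]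

lemma IsSONC.sum {n : ℕ} {ι : Type*} {s : Finset ι} {p : ι → MvPolynomial (Fin n) ℝ}
    (h : ∀ i ∈ s, IsSONC (p i)) : IsSONC (∑ i ∈ s, p i) :=
  Finset.sum_induction p IsSONC (fun _ _ => IsSONC.add) isSONC_zero h

lemma isSONC_monomial {n : ℕ} {α : Fin n →₀ ℕ} (hα : ∀ i, Even (α i)) {e : ℝ} (he : 0 ≤ e) :
    IsSONC (MvPolynomial.monomial α e) := by
  refine IsNonnegCircuit.isSONC (Or.inr ?_)
  choose r hr using hα
  refine ⟨Finsupp.equivFunOnFinite.symm r, Real.sqrt e, ?_⟩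
  have hadd : α = Finsupp.equivFunOnFinite.symm r + Finsupp.equivFunOnFinite.symm r := by
    ext i
    simp [hr]
  rw [sq, MvPolynomial.monomial_mul, Real.mul_self_sqrt he, ← hadd]

lemma IsNonnegCircuit.mem_sageCone {n : ℕ} {p : MvPolynomial (Fin n) ℝ} (hp : IsNonnegCircuit p) :
    toRatExpPoly p ∈ sageCone n := by
  rcases hp with ⟨⟨T, β, c, d, -, hc, rfl⟩, hnn⟩ | ⟨γ, a, rfl⟩
  · refine IsAGE.mem (β := ratPoint β) ⟨fun q hq => ?_, fun y => ?_⟩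
    · rw [← toRatHom_apply, map_sub, map_sum]
      simp only [toRatHom_monomial, AddMonoidAlgebra.coeff_sub, AddMonoidAlgebra.coeff_sum,
        Finsupp.sub_apply, Finset.sum_apply', coeff_ratTerm, if_neg hq.symm, sub_zero]
      refine Finset.sum_nonneg fun α hα => ?_
      split_ifs
      · exact (hc α hα).le
      · exact le_rfl
    · rw [expEval_toRatExpPoly]
      exact hnn _
  · rw [sq, MvPolynomial.monomial_mul, ← toRatHom_apply, toRatHom_monomial]
    exact (IsAGE.ratTerm 0 _ (mul_self_nonneg a)).mem

lemma IsSONC.mem_sageCone {n : ℕ} {f : MvPolynomial (Fin n) ℝ} (hf : IsSONC f) :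
    toRatExpPoly f ∈ sageCone n := by
  obtain ⟨N, g, hg, rfl⟩ := hf
  rw [← toRatHom_apply, map_sum]
  exact sum_mem fun j _ => (hg j).mem_sageCone

lemma eval_nonneg_of_eval_exp_nonneg {n : ℕ} {p : MvPolynomial (Fin n) ℝ}
    (h : ∀ y : Fin n → ℝ, 0 ≤ MvPolynomial.eval (fun i => Real.exp (y i)) p) {x : Fin n → ℝ}
    (hx : ∀ i, 0 ≤ x i) : 0 ≤ MvPolynomial.eval x p := by
  have hcont : Continuous fun t : ℝ => MvPolynomial.eval (fun i => x i + t) p :=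
    p.continuous_eval.comp (by fun_prop)
  have hlim : Filter.Tendsto (fun t : ℝ => MvPolynomial.eval (fun i => x i + t) p)
      (nhdsWithin 0 (Set.Ioi 0)) (nhds (MvPolynomial.eval x p)) := by
    have := (hcont.tendsto 0).mono_left (nhdsWithin_le_nhds (s := Set.Ioi 0))
    simpa using this
  refine ge_of_tendsto hlim ?_
  filter_upwards [self_mem_nhdsWithin] with t ht
  have := h fun i => Real.log (x i + t)
  have hexp : (fun i => Real.exp (Real.log (x i + t))) = fun i => x i + t :=
    funext fun i => Real.exp_log (add_pos_of_nonneg_of_pos (hx i) ht)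
  rwa [hexp] at this

/-- Passing from |x| to x leaves the outer terms unchanged, as their exponents are even, and cannot
decrease -d x^β, as d ≥ 0. So nonnegativity on the closed orthant suffices. -/
lemma isSONC_of_mem_circuitCone {n : ℕ} {S : Finset (Fin n →₀ ℕ)} {β : Fin n →₀ ℕ}
    {p : MvPolynomial (Fin n) ℝ} (hp : p ∈ circuitCone S β) : IsSONC p := by
  induction hp using AddSubmonoid.closure_induction with
  | zero => exact isSONC_zero
  | add p q _ _ hp hq => exact hp.add hq
  | mem p hp =>
    obtain ⟨T, -, hT, c, d, hc, hd, hage, rfl⟩ := hp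
    refine IsNonnegCircuit.isSONC (Or.inl ⟨⟨T, β, c, d, hT, hc, rfl⟩, fun x => ?_⟩)
    have habs : 0 ≤ MvPolynomial.eval (fun i => |x i|)
        (∑ α ∈ T, MvPolynomial.monomial α (c α) - MvPolynomial.monomial β d) := by
      refine eval_nonneg_of_eval_exp_nonneg (fun y => ?_) fun i => abs_nonneg _
      rw [← expEval_toRatExpPoly, ← toRatHom_apply, map_sub, map_sum, map_sub, map_sum]
      simp only [toRatHom_monomial, expEval_ratTerm, ratPoint, Rat.cast_natCast]
      exact sub_nonneg.mpr (hage y)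
    refine habs.trans ?_
    have hβ : ∏ i, x i ^ β i ≤ ∏ i, |x i| ^ β i := by
      refine (le_abs_self _).trans ?_
      rw [Finset.abs_prod]
      simp only [abs_pow, le_refl]
    have hα : ∀ α ∈ T, ∏ i, |x i| ^ α i = ∏ i, x i ^ α i := fun α hα =>
      Finset.prod_congr rfl fun i _ => (hT.even α hα i).pow_abs _
    simp only [map_sub, map_sum, MvPolynomial.eval_monomial, Finsupp.prod_fintype, pow_zero,
      implies_true]
    rw [Finset.sum_congr rfl fun α h => by rw [hα α h]]
    exact sub_le_sub_left (mul_le_mul_of_nonneg_left hβ hd) _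

/-- A PN-polynomial is SONC if and only if it is in the SAGE cone. -/
lemma IsPNPolynomial.isSONC_iff {n : ℕ} {f : MvPolynomial (Fin n) ℝ} (hf : IsPNPolynomial f) :
    IsSONC f ↔ toRatExpPoly f ∈ sageCone n := by
  refine ⟨IsSONC.mem_sageCone, fun h => ?_⟩
  obtain ⟨p, e, hp, he, hfe⟩ := hf.exists_circuit_add h
  rw [hfe]
  exact (IsSONC.sum fun β hβ => isSONC_of_mem_circuitCone (hp β hβ)).add
    (IsSONC.sum fun α hα => isSONC_monomial (mem_posSupport.mp hα).1 (he α))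

lemma IsPNPolynomial.isSONC_expand_iff {n : ℕ} {f : MvPolynomial (Fin n) ℝ}
    (hf : IsPNPolynomial f) {k : ℕ} (hk : 0 < k) :
    IsSONC f ↔ IsSONC (MvPolynomial.expand k f) := by
  rw [hf.isSONC_iff, (hf.expand hk).isSONC_iff, toRatExpPoly_expand,
    scaleExp_mem_sageCone_iff (by exact_mod_cast hk.ne')]

/-! ### Mediated sets -/

/-- Of two distinct points of `ℚⁿ`, one has larger squared norm than their midpoint. -/
lemma sum_sq_midpoint_lt {n : ℕ} {v w : Fin n → ℚ} (h : v ≠ w) :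
    ∑ i, ((1 / 2 : ℚ) • (v + w)) i ^ 2 < ∑ i, v i ^ 2 ∨
      ∑ i, ((1 / 2 : ℚ) • (v + w)) i ^ 2 < ∑ i, w i ^ 2 := by
  by_contra hcon
  push Not at hcon
  have hpos : 0 < ∑ i, (v i - w i) ^ 2 := by
    obtain ⟨i, hi⟩ := Function.ne_iff.mp h
    exact Finset.sum_pos' (fun i _ => sq_nonneg _)
      ⟨i, Finset.mem_univ i, by have := sub_ne_zero.mpr hi; positivity⟩
  have heq : 4 * ∑ i, ((1 / 2 : ℚ) • (v + w)) i ^ 2 + ∑ i, (v i - w i) ^ 2 =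
      2 * ∑ i, v i ^ 2 + 2 * ∑ i, w i ^ 2 := by
    simp only [Finset.mul_sum, ← Finset.sum_add_distrib]
    refine Finset.sum_congr rfl fun i _ => ?_
    simp only [Pi.smul_apply, Pi.add_apply, smul_eq_mul]
    ring
  linarith [hcon.1, hcon.2]

/-- Minimum principle: a function vanishing on `T` that is superharmonic on a mediated set is
nonnegative. -/
lemma nonneg_of_superharmonic {n : ℕ} {M T : Finset (Fin n → ℚ)}
    {v w : (Fin n → ℚ) → Fin n → ℚ} (hv : ∀ u ∈ M \ T, v u ∈ M) (hw : ∀ u ∈ M \ T, w u ∈ M)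
    (hne : ∀ u ∈ M \ T, v u ≠ w u) (hmid : ∀ u ∈ M \ T, u = (1 / 2 : ℚ) • (v u + w u))
    {h : (Fin n → ℚ) → ℝ} (hT : ∀ u ∈ T, h u = 0)
    (hh : ∀ u ∈ M \ T, h (v u) + h (w u) ≤ 2 * h u) : ∀ u ∈ M, 0 ≤ h u := by
  by_contra! hcon
  obtain ⟨u₁, hu₁, hneg⟩ := hcon
  obtain ⟨u₀, hu₀, hmin⟩ := M.exists_min_image h ⟨u₁, hu₁⟩
  have hneg₀ : h u₀ < 0 := (hmin u₁ hu₁).trans_lt hneg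
  -- Among the minimizers take one farthest from the origin. Superharmonicity makes both `v u` and
  -- `w u` minimizers, yet one of them is farther out than their midpoint u.
  obtain ⟨u, hu, hmax⟩ := (M.filter fun u => h u = h u₀).exists_max_image
    (fun u => ∑ i, u i ^ 2) ⟨u₀, Finset.mem_filter.mpr ⟨hu₀, rfl⟩⟩
  obtain ⟨huM, huu⟩ := Finset.mem_filter.mp hu
  have huT : u ∈ M \ T := Finset.mem_sdiff.mpr ⟨huM, fun h' => by
    have := hT u h'
    linarith⟩
  have h1 := hmin _ (hv u huT)
  have h2 := hmin _ (hw u huT)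
  have h3 := hh u huT
  have hv' := hmax _ (Finset.mem_filter.mpr ⟨hv u huT, by linarith⟩)
  have hw' := hmax _ (Finset.mem_filter.mpr ⟨hw u huT, by linarith⟩)
  have h4 := sum_sq_midpoint_lt (hne u huT)
  rw [← hmid u huT] at h4
  rcases h4 with h4 | h4 <;> linarith

/-- The Green function of a mediated set: a discrete Poisson formula with nonnegative weights. -/
lemma exists_green {n : ℕ} {M T : Finset (Fin n → ℚ)}
    {v w : (Fin n → ℚ) → Fin n → ℚ} (hv : ∀ u ∈ M \ T, v u ∈ M) (hw : ∀ u ∈ M \ T, w u ∈ M)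
    (hne : ∀ u ∈ M \ T, v u ≠ w u) (hmid : ∀ u ∈ M \ T, u = (1 / 2 : ℚ) • (v u + w u))
    {β : Fin n → ℚ} (hβ : β ∈ M \ T) :
    ∃ s : (Fin n → ℚ) → ℝ, (∀ u ∈ M \ T, 0 ≤ s u) ∧
      ∀ h : (Fin n → ℚ) → ℝ, ∑ u ∈ M \ T, s u * (h (v u) + h (w u) - 2 * h u) =
        ∑ α ∈ T, (∑ u ∈ M \ T, s u * ((if v u = α then 1 else 0) + (if w u = α then 1 else 0)))
          * h α - h β := by
  classical
  set U := M \ T with hU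
  set ext : (U → ℝ) → (Fin n → ℚ) → ℝ := fun g u => if hu : u ∈ U then g ⟨u, hu⟩ else 0 with hext
  have ext_mem : ∀ g u (hu : u ∈ U), ext g u = g ⟨u, hu⟩ := fun g u hu => dif_pos hu
  have ext_T : ∀ g, ∀ u ∈ T, ext g u = 0 := fun g u hu =>
    dif_neg fun h => (Finset.mem_sdiff.mp h).2 hu
  -- The discrete Laplacian with zero boundary values on T. The minimum principle makes it
  -- injective, hence bijective, with a nonnegative inverse.
  set L : (U → ℝ) →ₗ[ℝ] (U → ℝ) :=
    { toFun := fun g u => 2 * g u - ext g (v u) - ext g (w u)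
      map_add' := fun g g' => by
        funext u
        simp only [hext, Pi.add_apply]
        split_ifs <;> ring
      map_smul' := fun c g => by
        funext u
        simp only [hext, Pi.smul_apply, smul_eq_mul, RingHom.id_apply]
        split_ifs <;> ring } with hL
  have hLapp : ∀ g u, L g u = 2 * g u - ext g (v u) - ext g (w u) := fun _ _ => rfl
  have hnonneg : ∀ g, (∀ u, 0 ≤ L g u) → ∀ u, 0 ≤ g u := by
    intro g hg u
    have := nonneg_of_superharmonic hv hw hne hmid (ext_T g) (fun u hu => by
      have := hg ⟨u, hu⟩
      rw [hLapp] at this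
      rw [ext_mem g u hu]
      linarith) u (Finset.mem_sdiff.mp u.2).1
    rwa [ext_mem g u u.2] at this
  have hinj : Function.Injective L := by
    refine (injective_iff_map_eq_zero L).mpr fun g hg => ?_
    funext u
    refine le_antisymm ?_ (hnonneg g (fun u => by rw [hg]; exact le_rfl) u)
    have := hnonneg (-g) (fun u => by rw [map_neg, hg, neg_zero]; exact le_rfl) u
    simpa using this
  have hsurj : Function.Surjective L := LinearMap.injective_iff_surjective.mp hinj
  have hG : ∀ u : U, ∃ g, L g = Pi.single u 1 := fun u => hsurj _
  choose G hG using hG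
  have hGpos : ∀ u u', 0 ≤ G u u' := fun u => hnonneg (G u) fun u' => by
    rw [hG, Pi.single_apply]
    split_ifs <;> norm_num
  have hrep : ∀ g : U → ℝ, g = ∑ u, L g u • G u := by
    intro g
    apply hinj
    rw [map_sum]
    simp only [map_smul, hG]
    funext u'
    simp [Finset.sum_apply, Pi.single_apply]
  -- The row of the inverse of L at β: evaluating `hrep` at β expresses g β through the values L g u
  -- with these weights.
  set s : (Fin n → ℚ) → ℝ := ext fun u => G u ⟨β, hβ⟩ with hs
  have hsmem : ∀ u : U, s u = G u ⟨β, hβ⟩ :=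
    fun u => ext_mem (fun u => G u ⟨β, hβ⟩) u u.2
  refine ⟨s, fun u hu => ?_, fun h => ?_⟩
  · rw [hsmem ⟨u, hu⟩]
    exact hGpos _ _
  · set g : U → ℝ := fun u => h u with hg
    have hsplit : ∀ q ∈ M, h q = ext g q + ∑ α ∈ T, (if q = α then 1 else 0) * h α := by
      intro q hq
      by_cases hqT : q ∈ T
      · rw [ext_T g q hqT, zero_add]
        simp [hqT]
      · rw [ext_mem g q (Finset.mem_sdiff.mpr ⟨hq, hqT⟩), Finset.sum_eq_zero, add_zero]
        intro α hα
        rw [if_neg (ne_of_mem_of_not_mem hα hqT).symm, zero_mul]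
    have hβ' : h β = ∑ u ∈ U, s u * (2 * h u - ext g (v u) - ext g (w u)) := by
      have h1 := congrFun (hrep g) ⟨β, hβ⟩
      rw [← Finset.sum_coe_sort U fun u => s u * (2 * h u - ext g (v u) - ext g (w u))]
      refine h1.trans ?_
      rw [Finset.sum_apply]
      refine Finset.sum_congr rfl fun u _ => ?_
      rw [Pi.smul_apply, smul_eq_mul, hsmem, hLapp, mul_comm]
    rw [hβ']
    simp only [Finset.sum_mul]
    rw [Finset.sum_comm, ← Finset.sum_sub_distrib]
    refine Finset.sum_congr rfl fun u hu => ?_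
    rw [hsplit _ (hv u hu), hsplit _ (hw u hu)]
    simp only [mul_add, add_mul, mul_sub, Finset.mul_sum, Finset.sum_add_distrib, mul_assoc]
    ring

/-! ### Circuits as sums of binomial squares -/

/-- Affine independence of the z a is linear independence of the lifts (1, z a), on which a linear
functional may take any values. -/
lemma exists_affine_interpolation {ι : Type*} {n : ℕ} {z : ι → Fin n → ℝ}
    (hz : AffineIndependent ℝ z) (r : ι → ℝ) :
    ∃ (t₀ : ℝ) (t : Fin n → ℝ), ∀ a, t₀ + ∑ i, z a i * t i = r a := by
  classical
  have hlin : LinearIndependent ℝ (fun a => ((1 : ℝ), z a)) := by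
    rw [linearIndependent_iff']
    intro s g hg
    rw [affineIndependent_iff] at hz
    refine hz s g ?_ ?_
    · simpa [Prod.fst_sum] using congrArg Prod.fst hg
    · simpa [Prod.snd_sum] using congrArg Prod.snd hg
  obtain ⟨g, hg⟩ := LinearMap.exists_leftInverse_of_injective
    (Finsupp.linearCombination ℝ fun a => ((1 : ℝ), z a)) (LinearMap.ker_eq_bot.mpr hlin)
  set φ := (Finsupp.linearCombination ℝ r).comp g with hφ
  have hφz : ∀ a, φ (1, z a) = r a := by
    intro a
    have := LinearMap.congr_fun hg (Finsupp.single a 1)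
    simp only [LinearMap.comp_apply, Finsupp.linearCombination_single, one_smul,
      LinearMap.id_apply] at this
    rw [hφ, LinearMap.comp_apply, this, Finsupp.linearCombination_single, one_smul]
  refine ⟨φ (1, 0), fun i => φ (0, Pi.single i 1), fun a => ?_⟩
  rw [← hφz a]
  have : ((1 : ℝ), z a) = (1, 0) + ∑ i, z a i • ((0 : ℝ), (Pi.single i 1 : Fin n → ℝ)) := by
    ext j
    · simp [Prod.fst_sum]
    · simp [Prod.snd_sum, Finset.sum_apply, Pi.single_apply]
  rw [this, map_add, map_sum]
  simp only [map_smul, smul_eq_mul]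

lemma IsCircuit.weights_unique {n : ℕ} {T : Finset (Fin n →₀ ℕ)} {β : Fin n →₀ ℕ}
    (hT : IsCircuit T β) {l m : (Fin n →₀ ℕ) → ℝ} (h1 : ∑ α ∈ T, l α = ∑ α ∈ T, m α)
    (h2 : ∀ i, ∑ α ∈ T, l α * (α i : ℝ) = ∑ α ∈ T, m α * (α i : ℝ)) : ∀ α ∈ T, l α = m α := by
  intro α hα
  have h := affineIndependent_iff.mp hT.affineIndependent Finset.univ
    (fun α => l α - m α) ?_ ?_ ⟨α, hα⟩ (Finset.mem_univ _)
  · exact sub_eq_zero.mp h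
  · rw [Finset.sum_coe_sort T fun α => l α - m α, Finset.sum_sub_distrib, h1, sub_self]
  · funext i
    rw [Finset.sum_apply]
    refine (Finset.sum_coe_sort T fun α => (l α - m α) * (α i : ℝ)).trans ?_
    simp only [sub_mul, Finset.sum_sub_distrib, h2, sub_self, Pi.zero_apply]

/-- The weights of the discrete Poisson formula of a mediated set of a circuit are the barycentric
coordinates of the inner exponent. -/
lemma IsCircuit.exists_green {n : ℕ} {T : Finset (Fin n →₀ ℕ)} {β : Fin n →₀ ℕ}
    (hT : IsCircuit T β) {M : Finset (Fin n → ℚ)} {v w : (Fin n → ℚ) → Fin n → ℚ}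
    (hv : ∀ u ∈ M \ ratPoints T, v u ∈ M) (hw : ∀ u ∈ M \ ratPoints T, w u ∈ M)
    (hne : ∀ u ∈ M \ ratPoints T, v u ≠ w u)
    (hmid : ∀ u ∈ M \ ratPoints T, u = (1 / 2 : ℚ) • (v u + w u))
    (hβ : ratPoint β ∈ M \ ratPoints T) :
    ∃ (s : (Fin n → ℚ) → ℝ) (l : (Fin n →₀ ℕ) → ℝ), (∀ u ∈ M \ ratPoints T, 0 ≤ s u) ∧
      (∀ α ∈ T, 0 < l α) ∧ ∑ α ∈ T, l α = 1 ∧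
      (∀ α ∈ T, ∃ u ∈ M \ ratPoints T, v u = ratPoint α ∨ w u = ratPoint α) ∧
      ∀ h : (Fin n → ℚ) → ℝ, ∑ u ∈ M \ ratPoints T, s u * (h (v u) + h (w u) - 2 * h u) =
        ∑ α ∈ T, l α * h (ratPoint α) - h (ratPoint β) := by
  classical
  obtain ⟨s, hs, hgreen⟩ := _root_.exists_green hv hw hne hmid hβ
  obtain ⟨l, hl, hl1, hlβ⟩ := hT.mem_interior
  set m : (Fin n →₀ ℕ) → ℝ := fun α => ∑ u ∈ M \ ratPoints T, s u *
    ((if v u = ratPoint α then 1 else 0) + (if w u = ratPoint α then 1 else 0)) with hm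
  have hgreen' : ∀ h : (Fin n → ℚ) → ℝ,
      ∑ u ∈ M \ ratPoints T, s u * (h (v u) + h (w u) - 2 * h u) =
        ∑ α ∈ T, m α * h (ratPoint α) - h (ratPoint β) := by
    intro h
    rw [hgreen h]
    congr 1
    exact Finset.sum_image ratPoint_injective.injOn
  -- Constants and coordinates are harmonic, so testing the formula on them shows that m gives
  -- barycentric coordinates of β. These are unique, hence equal to l and positive.
  have hm1 : ∑ α ∈ T, m α = 1 := by
    have := hgreen' fun _ => 1
    simp only [mul_one] at this
    rw [Finset.sum_eq_zero fun u _ => by norm_num] at this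
    linarith
  have hmβ : ∀ i, ∑ α ∈ T, m α * (α i : ℝ) = (β i : ℝ) := by
    intro i
    have := hgreen' fun q => (q i : ℝ)
    rw [Finset.sum_eq_zero fun u hu => by
      have h1 := congrFun (hmid u hu) i
      have h2 : (u i : ℝ) = (1 / 2) * ((v u i : ℝ) + (w u i : ℝ)) := by
        rw [h1]
        simp
      rw [h2]
      ring] at this
    simp only [ratPoint, Rat.cast_natCast] at this
    linarith
  have hlm := hT.weights_unique (l := m) (m := l) (by rw [hm1, hl1])
    (fun i => by rw [hmβ, hlβ])
  have hmpos : ∀ α ∈ T, 0 < m α := fun α hα => by rw [hlm α hα]; exact hl α hα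
  refine ⟨s, m, hs, hmpos, hm1, fun α hα => ?_, hgreen'⟩
  by_contra! hcon
  refine (hmpos α hα).ne' (Finset.sum_eq_zero fun u hu => ?_)
  rw [if_neg (hcon u hu).1, if_neg (hcon u hu).2]
  norm_num

/-- Sums of squares of binomials in `x^(v u / 2)`, `x^(w u / 2)` for `u ∈ U`. -/
def binomialSquareCone {n : ℕ} (U : Finset (Fin n → ℚ)) (v w : (Fin n → ℚ) → Fin n → ℚ) :
    AddSubmonoid (RatExpPoly n) :=
  AddSubmonoid.closure {p | ∃ u ∈ U, ∃ a b : ℝ, p = binomialSquare (v u) (w u) a b}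

lemma ratTerm_zero {n : ℕ} (q : Fin n → ℚ) : ratTerm q 0 = 0 := AddMonoidAlgebra.single_zero _

lemma ratTerm_mem_binomialSquareCone {n : ℕ} {U : Finset (Fin n → ℚ)}
    {v w : (Fin n → ℚ) → Fin n → ℚ} {q : Fin n → ℚ} (hq : ∃ u ∈ U, v u = q ∨ w u = q) {e : ℝ}
    (he : 0 ≤ e) : ratTerm q e ∈ binomialSquareCone U v w := by
  obtain ⟨u, hu, rfl | rfl⟩ := hq
  · refine AddSubmonoid.subset_closure ⟨u, hu, Real.sqrt e, 0, ?_⟩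
    rw [binomialSquare_eq, Real.sq_sqrt he, mul_zero, zero_pow two_ne_zero, ratTerm_zero,
      ratTerm_zero, add_zero, sub_zero]
  · refine AddSubmonoid.subset_closure ⟨u, hu, 0, Real.sqrt e, ?_⟩
    rw [binomialSquare_eq, Real.sq_sqrt he, mul_zero, zero_mul, zero_pow two_ne_zero, ratTerm_zero,
      ratTerm_zero, zero_add, sub_zero]

/-- A nonnegative circuit is a sum of binomial squares along any mediated set. -/
lemma IsCircuit.mem_binomialSquareCone {n : ℕ} {T : Finset (Fin n →₀ ℕ)} {β : Fin n →₀ ℕ}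
    (hT : IsCircuit T β) {M : Finset (Fin n → ℚ)} {v w : (Fin n → ℚ) → Fin n → ℚ}
    (hv : ∀ u ∈ M \ ratPoints T, v u ∈ M) (hw : ∀ u ∈ M \ ratPoints T, w u ∈ M)
    (hne : ∀ u ∈ M \ ratPoints T, v u ≠ w u)
    (hmid : ∀ u ∈ M \ ratPoints T, u = (1 / 2 : ℚ) • (v u + w u))
    (hβ : ratPoint β ∈ M \ ratPoints T) {c : (Fin n →₀ ℕ) → ℝ} {d : ℝ}
    (hc : ∀ α ∈ T, 0 < c α) (hd : 0 ≤ d)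
    (hage : ∀ y : Fin n → ℝ, d * Real.exp (∑ i, (β i : ℝ) * y i) ≤
      ∑ α ∈ T, c α * Real.exp (∑ i, (α i : ℝ) * y i)) :
    ∑ α ∈ T, ratTerm (ratPoint α) (c α) - ratTerm (ratPoint β) d
      ∈ binomialSquareCone (M \ ratPoints T) v w := by
  classical
  obtain ⟨s, l, hs, hl, hl1, hcover, hgreen⟩ := hT.exists_green hv hw hne hmid hβ
  obtain ⟨t₀, t, ht⟩ := exists_affine_interpolation hT.affineIndependent
    fun α => Real.log (c α / l α)
  replace ht : ∀ α ∈ T, t₀ + ∑ i, (α i : ℝ) * t i = Real.log (c α / l α) :=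
    fun α hα => ht ⟨α, hα⟩
  -- Since l α exp(ℓ α) = c α, the weight exp ∘ ℓ reduces the coefficients to barycentric ones;
  -- being affine, ℓ respects midpoints.
  set ℓ : (Fin n → ℚ) → ℝ := fun q => t₀ + ∑ i, (q i : ℝ) * t i with hℓ
  have hℓmid : ∀ p q : Fin n → ℚ, ℓ ((1 / 2 : ℚ) • (p + q)) = ℓ p / 2 + ℓ q / 2 := by
    intro p q
    have : ∀ i, (((1 / 2 : ℚ) • (p + q)) i : ℝ) * t i =
        (p i : ℝ) * t i / 2 + (q i : ℝ) * t i / 2 := fun i => by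
      simp only [Pi.smul_apply, Pi.add_apply, smul_eq_mul]
      push_cast
      ring
    simp only [hℓ, this, Finset.sum_add_distrib, ← Finset.sum_div]
    ring
  have hℓT : ∀ α ∈ T, l α * Real.exp (ℓ (ratPoint α)) = c α := fun α hα => by
    have : ℓ (ratPoint α) = Real.log (c α / l α) := by
      rw [← ht α hα]
      simp [hℓ, ratPoint]
    rw [this, Real.exp_log (div_pos (hc α hα) (hl α hα)), mul_div_cancel₀ _ (hl α hα).ne']
  set X := Real.exp (ℓ (ratPoint β)) with hX
  have hXpos : 0 < X := Real.exp_pos _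
  -- X is the largest admissible inner coefficient: at y = -t all exponentials c α exp(α·y) are
  -- proportional to l α, the equality case of weighted AM-GM.
  have hdX : d ≤ X := by
    have h1 := hage fun i => -t i
    have h2 : ∑ α ∈ T, c α * Real.exp (∑ i, (α i : ℝ) * -t i) = Real.exp t₀ := by
      rw [← one_mul (Real.exp t₀), ← hl1, Finset.sum_mul]
      refine Finset.sum_congr rfl fun α hα => ?_
      rw [← hℓT α hα, mul_assoc, ← Real.exp_add]
      simp [hℓ, ratPoint]
    have h3 : X = Real.exp t₀ * Real.exp (∑ i, (β i : ℝ) * t i) := by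
      rw [hX, ← Real.exp_add]
      simp [hℓ, ratPoint]
    rw [h2] at h1
    calc d = d * Real.exp (∑ i, (β i : ℝ) * -t i) * Real.exp (∑ i, (β i : ℝ) * t i) := by
          rw [mul_assoc, ← Real.exp_add]
          simp
      _ ≤ X := h3 ▸ mul_le_mul_of_nonneg_right h1 (Real.exp_nonneg _)
  -- The part ρ of the outer coefficients matches d exactly; the slack 1 - ρ is left as positive
  -- monomials.
  set ρ := d / X with hρ
  have hρ0 : 0 ≤ ρ := div_nonneg hd hXpos.le
  have hρ1 : ρ ≤ 1 := (div_le_one hXpos).mpr hdX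
  have hsq : ∀ u ∈ M \ ratPoints T,
      binomialSquare (v u) (w u) (Real.sqrt (ρ * s u) * Real.exp (ℓ (v u) / 2))
        (Real.sqrt (ρ * s u) * Real.exp (ℓ (w u) / 2)) =
      ratTerm (v u) (ρ * s u * Real.exp (ℓ (v u))) + ratTerm (w u) (ρ * s u * Real.exp (ℓ (w u)))
        - ratTerm u (ρ * s u * (2 * Real.exp (ℓ u))) := by
    intro u hu
    have hss : Real.sqrt (ρ * s u) ^ 2 = ρ * s u := Real.sq_sqrt (mul_nonneg hρ0 (hs u hu))
    have hexp : ∀ x : ℝ, Real.exp (x / 2) ^ 2 = Real.exp x := fun x => by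
      rw [sq, ← Real.exp_add, add_halves]
    have hu' : Real.exp (ℓ u) = Real.exp (ℓ (v u) / 2) * Real.exp (ℓ (w u) / 2) := by
      rw [← Real.exp_add, ← hℓmid, ← hmid u hu]
    rw [binomialSquare_eq, ← hmid u hu, mul_pow, mul_pow, hss, hexp, hexp, hu']
    congr 2
    linear_combination (2 * Real.exp (ℓ (v u) / 2) * Real.exp (ℓ (w u) / 2)) * hss
  have hmain : ∑ u ∈ M \ ratPoints T,
      binomialSquare (v u) (w u) (Real.sqrt (ρ * s u) * Real.exp (ℓ (v u) / 2))
        (Real.sqrt (ρ * s u) * Real.exp (ℓ (w u) / 2)) =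
      ∑ α ∈ T, ratTerm (ratPoint α) (ρ * c α) - ratTerm (ratPoint β) d := by
    rw [Finset.sum_congr rfl hsq]
    ext q
    -- This test function extracts the coefficient of x^q from the Poisson formula weighted by exp ∘
    -- ℓ.
    have h1 := hgreen fun p => if p = q then Real.exp (ℓ p) else 0
    simp only [AddMonoidAlgebra.coeff_sub, AddMonoidAlgebra.coeff_add, AddMonoidAlgebra.coeff_sum,
      Finsupp.sub_apply, Finsupp.add_apply, Finset.sum_apply', coeff_ratTerm]
    have h2 : ∑ α ∈ T, (if ratPoint α = q then ρ * c α else 0)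
        - (if ratPoint β = q then d else 0) =
        ρ * (∑ α ∈ T, l α * (if ratPoint α = q then Real.exp (ℓ (ratPoint α)) else 0)
          - (if ratPoint β = q then Real.exp (ℓ (ratPoint β)) else 0)) := by
      rw [mul_sub, Finset.mul_sum]
      congr 1
      · refine Finset.sum_congr rfl fun α hα => ?_
        split_ifs
        · rw [hℓT α hα]
        · simp
      · split_ifs
        · rw [hρ, ← hX, div_mul_cancel₀ _ hXpos.ne']
        · simp
    rw [h2, ← h1, Finset.mul_sum]
    refine Finset.sum_congr rfl fun u _ => ?_
    split_ifs <;> ring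
  have hdecomp : ∑ α ∈ T, ratTerm (ratPoint α) (c α) - ratTerm (ratPoint β) d =
      (∑ α ∈ T, ratTerm (ratPoint α) (ρ * c α) - ratTerm (ratPoint β) d)
        + ∑ α ∈ T, ratTerm (ratPoint α) ((1 - ρ) * c α) := by
    rw [sub_add_eq_add_sub, ← Finset.sum_add_distrib]
    congr 1
    refine Finset.sum_congr rfl fun α _ => ?_
    rw [← ratTerm_add]
    congr 1
    ring
  rw [hdecomp, ← hmain]
  exact add_mem
    (sum_mem fun u hu => AddSubmonoid.subset_closure ⟨u, hu, _, _, rfl⟩)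
    (sum_mem fun α hα => ratTerm_mem_binomialSquareCone (hcover α hα)
      (mul_nonneg (sub_nonneg.mpr hρ1) (hc α hα).le))

/-- A positive semidefinite binary quadratic form is a sum of two squares. -/
lemma exists_two_squares {A B C : ℝ} (hA : 0 ≤ A) (hC : 0 ≤ C) (h : B ^ 2 ≤ A * C) :
    ∃ a b : Fin 2 → ℝ, ∑ j, a j ^ 2 = A ∧ ∑ j, b j ^ 2 = C ∧ ∑ j, a j * b j = B := by
  rcases hA.eq_or_lt with rfl | hA
  · have hB : B = 0 := by
      rw [zero_mul] at h
      exact pow_eq_zero_iff two_ne_zero |>.mp (le_antisymm h (sq_nonneg B))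
    refine ⟨![0, 0], ![0, Real.sqrt C], ?_, ?_, ?_⟩ <;> simp [Real.sq_sqrt hC, hB]
  · have hs : Real.sqrt A ≠ 0 := (Real.sqrt_pos.mpr hA).ne'
    have hC' : 0 ≤ C - B ^ 2 / A := by
      rw [sub_nonneg, div_le_iff₀ hA, mul_comm]
      exact h
    -- Completing the square.
    refine ⟨![Real.sqrt A, 0], ![B / Real.sqrt A, Real.sqrt (C - B ^ 2 / A)], ?_, ?_, ?_⟩
    · simp [Real.sq_sqrt hA.le]
    · simp [Real.sq_sqrt hC', div_pow, Real.sq_sqrt hA.le]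
    · simp [mul_div_cancel₀ _ hs]

lemma sum_binomialSquare_eq {n : ℕ} (v w : Fin n → ℚ) {ι : Type*} (s : Finset ι) (a b : ι → ℝ) :
    ∑ j ∈ s, binomialSquare v w (a j) (b j) = ratTerm v (∑ j ∈ s, a j ^ 2)
      + ratTerm w (∑ j ∈ s, b j ^ 2)
      - ratTerm ((1 / 2 : ℚ) • (v + w)) (2 * ∑ j ∈ s, a j * b j) := by
  have hsum : ∀ (q : Fin n → ℚ) (g : ι → ℝ), ratTerm q (∑ j ∈ s, g j) = ∑ j ∈ s, ratTerm q (g j) :=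
    fun q g => map_sum (AddMonoidAlgebra.singleAddHom q) g s
  rw [Finset.mul_sum, hsum, hsum, hsum]
  simp only [binomialSquare_eq, Finset.sum_sub_distrib, Finset.sum_add_distrib, mul_assoc]

/-- Four squares in the same two monomials still form one positive semidefinite binary form, by
Cauchy–Schwarz on the concatenated coefficients. This makes the sums with exactly two squares per u
closed under addition. -/
lemma exists_add_binomialSquare {n : ℕ} (v w : Fin n → ℚ) (a b a' b' : Fin 2 → ℝ) :
    ∃ a₂ b₂ : Fin 2 → ℝ, ∑ j, binomialSquare v w (a j) (b j)
      + ∑ j, binomialSquare v w (a' j) (b' j) = ∑ j, binomialSquare v w (a₂ j) (b₂ j) := by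
  have hcs := Finset.sum_mul_sq_le_sq_mul_sq Finset.univ (Sum.elim a a') (Sum.elim b b')
  obtain ⟨a₂, b₂, h1, h2, h3⟩ := exists_two_squares
    (Finset.sum_nonneg fun _ _ => sq_nonneg _) (Finset.sum_nonneg fun _ _ => sq_nonneg _) hcs
  refine ⟨a₂, b₂, ?_⟩
  rw [sum_binomialSquare_eq v w Finset.univ a₂ b₂, h1, h2, h3,
    ← sum_binomialSquare_eq v w Finset.univ (Sum.elim a a') (Sum.elim b b'), Fintype.sum_sum_type]
  simp

/-! ### The main theorem -/

lemma binomialSquare_zero {n : ℕ} (v w : Fin n → ℚ) : binomialSquare v w 0 0 = 0 := by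
  simp [binomialSquare, ratTerm_zero]

lemma exists_sum_of_mem_closure_binomialSquare {n : ℕ} {P : Finset (Fin n → ℚ)}
    {g : RatExpPoly n} (hg : g ∈ AddSubmonoid.closure
      {g | ∃ p ∈ P, ∃ q ∈ P, ∃ a b : ℝ, g = binomialSquare p q a b}) :
    ∃ (N : ℕ) (p q : Fin N → (Fin n → ℚ)) (a b : Fin N → ℝ), (∀ j, p j ∈ P ∧ q j ∈ P) ∧
      g = ∑ j, binomialSquare (p j) (q j) (a j) (b j) := by
  induction hg using AddSubmonoid.closure_induction with
  | mem g hg =>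
    obtain ⟨p, hp, q, hq, a, b, rfl⟩ := hg
    exact ⟨1, fun _ => p, fun _ => q, fun _ => a, fun _ => b, fun _ => ⟨hp, hq⟩, by simp⟩
  | zero => exact ⟨0, fun _ => 0, fun _ => 0, fun _ => 0, fun _ => 0, fun j => j.elim0, by simp⟩
  | add g g' _ _ hg hg' =>
    obtain ⟨N, p, q, a, b, h, rfl⟩ := hg
    obtain ⟨N', p', q', a', b', h', rfl⟩ := hg'
    refine ⟨N + N', Fin.append p p', Fin.append q q', Fin.append a a', Fin.append b b',
      fun j => ?_, ?_⟩
    · refine Fin.addCases (fun i => ?_) (fun i => ?_) j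
      · simpa only [Fin.append_left] using h i
      · simpa only [Fin.append_right] using h' i
    · rw [Fin.sum_univ_add]
      simp only [Fin.append_left, Fin.append_right]

/-- Sums of pairs of binomial squares indexed by `u ∈ U β T`, `T ∈ C β`, `β ∈ B`. -/
def indexedSquareCone {n : ℕ} {κ τ : Type*} (B : Finset κ) (C : κ → Finset τ)
    (U : κ → τ → Finset (Fin n → ℚ)) (v w : κ → τ → (Fin n → ℚ) → (Fin n → ℚ)) :
    AddSubmonoid (RatExpPoly n) where
  carrier := {g | ∃ a b : κ → τ → (Fin n → ℚ) → Fin 2 → ℝ,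
    g = ∑ β ∈ B, ∑ T ∈ C β, ∑ u ∈ U β T, ∑ j : Fin 2,
      binomialSquare (v β T u) (w β T u) (a β T u j) (b β T u j)}
  zero_mem' := ⟨0, 0, by simp [binomialSquare_zero]⟩
  add_mem' := by
    rintro _ _ ⟨a, b, rfl⟩ ⟨a', b', rfl⟩
    choose a₂ b₂ h using fun β T u => exists_add_binomialSquare (v β T u) (w β T u)
      (a β T u) (b β T u) (a' β T u) (b' β T u)
    exact ⟨a₂, b₂, by simp only [← h, Finset.sum_add_distrib]⟩

lemma binomialSquareCone_le_indexedSquareCone {n : ℕ} {κ τ : Type*} {B : Finset κ}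
    {C : κ → Finset τ} {U : κ → τ → Finset (Fin n → ℚ)}
    {v w : κ → τ → (Fin n → ℚ) → (Fin n → ℚ)} {β : κ} (hβ : β ∈ B) {T : τ} (hT : T ∈ C β) :
    binomialSquareCone (U β T) (v β T) (w β T) ≤ indexedSquareCone B C U v w := by
  classical
  refine AddSubmonoid.closure_le.mpr ?_
  rintro _ ⟨u, hu, a, b, rfl⟩
  refine ⟨fun β' T' u' j => if β' = β ∧ T' = T ∧ u' = u ∧ j = 0 then a else 0,
    fun β' T' u' j => if β' = β ∧ T' = T ∧ u' = u ∧ j = 0 then b else 0, ?_⟩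
  rw [Finset.sum_eq_single_of_mem β hβ, Finset.sum_eq_single_of_mem T hT,
    Finset.sum_eq_single_of_mem u hu]
  · simp [binomialSquare_zero]
  · intro u' _ h
    simp [h, binomialSquare_zero]
  · intro T' _ h
    simp [h, binomialSquare_zero]
  · intro β' _ h
    simp [h, binomialSquare_zero]

lemma mem_circuitsAt {n : ℕ} {f : MvPolynomial (Fin n) ℝ} {β : Fin n →₀ ℕ}
    {T : Finset (Fin n →₀ ℕ)} : T ∈ circuitsAt f β ↔ T ⊆ posSupport f ∧ IsCircuit T β := by
  simp only [circuitsAt, Finset.mem_filter, Finset.mem_powerset]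

lemma notMem_posSupport_of_mem_negSupport {n : ℕ} {f : MvPolynomial (Fin n) ℝ} {β : Fin n →₀ ℕ}
    (hβ : β ∈ negSupport f) : β ∉ posSupport f := by
  rw [negSupport, Finset.mem_sdiff] at hβ
  exact hβ.2

lemma mem_uncoveredSupport {n : ℕ} {f : MvPolynomial (Fin n) ℝ} {α : Fin n →₀ ℕ} :
    α ∈ uncoveredSupport f ↔ α ∈ posSupport f ∧
      ∀ β ∈ negSupport f, ∀ T ∈ circuitsAt f β, α ∉ T := by
  simp only [uncoveredSupport, Finset.mem_filter]

lemma coeff_eq_zero_of_mem_circuitCone {n : ℕ} {f p : MvPolynomial (Fin n) ℝ}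
    {α β : Fin n →₀ ℕ} (hα : α ∈ uncoveredSupport f) (hβ : β ∈ negSupport f)
    (hp : p ∈ circuitCone (posSupport f) β) : p.coeff α = 0 := by
  classical
  obtain ⟨hα₁, hα₂⟩ := mem_uncoveredSupport.mp hα
  induction hp using AddSubmonoid.closure_induction with
  | zero => simp
  | add p q _ _ hp hq => rw [MvPolynomial.coeff_add, hp, hq, add_zero]
  | mem p hp =>
    obtain ⟨T, hTS, hT, c, d, -, -, -, rfl⟩ := hp
    have hβα : β ≠ α := (ne_of_mem_of_not_mem hα₁ (notMem_posSupport_of_mem_negSupport hβ)).symm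
    rw [MvPolynomial.coeff_sub, MvPolynomial.coeff_sum, MvPolynomial.coeff_monomial, if_neg hβα,
      sub_zero]
    refine Finset.sum_eq_zero fun γ hγ => ?_
    rw [MvPolynomial.coeff_monomial, if_neg]
    rintro rfl
    exact hα₂ β hβ T (mem_circuitsAt.mpr ⟨hTS, hT⟩) hγ

/-- A SONC PN-polynomial is a sum of binomial squares along given mediated sets, up to the terms
that lie in no circuit. -/
lemma IsPNPolynomial.exists_binomialSquares {n : ℕ} {f : MvPolynomial (Fin n) ℝ}
    (hf : IsPNPolynomial f) {M : (Fin n →₀ ℕ) → Finset (Fin n →₀ ℕ) → Finset (Fin n → ℚ)}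
    (hM : ∀ β ∈ negSupport f, ∀ T ∈ circuitsAt f β, ratPoint β ∈ M β T)
    {v w : (Fin n →₀ ℕ) → Finset (Fin n →₀ ℕ) → (Fin n → ℚ) → (Fin n → ℚ)}
    (hvw : ∀ β ∈ negSupport f, ∀ T ∈ circuitsAt f β, ∀ u ∈ M β T \ ratPoints T,
      v β T u ∈ M β T ∧ w β T u ∈ M β T ∧ v β T u ≠ w β T u ∧
        u = (1 / 2 : ℚ) • (v β T u + w β T u)) (hs : IsSONC f) :
    ∃ g ∈ indexedSquareCone (negSupport f) (circuitsAt f) (fun β T => M β T \ ratPoints T) v w,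
      toRatExpPoly f = g + ∑ α ∈ uncoveredSupport f, ratTerm (ratPoint α) (f.coeff α) := by
  classical
  obtain ⟨p, e, hp, he, hfe⟩ := hf.exists_circuit_add hs.mem_sageCone
  set W := indexedSquareCone (negSupport f) (circuitsAt f) (fun β T => M β T \ ratPoints T) v w
    with hW
  have hβmem : ∀ β ∈ negSupport f, ∀ T ∈ circuitsAt f β, ratPoint β ∈ M β T \ ratPoints T := by
    intro β hβ T hT
    refine Finset.mem_sdiff.mpr ⟨hM β hβ T hT, fun h => ?_⟩
    obtain ⟨γ, hγ, hγβ⟩ := Finset.mem_image.mp h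
    rw [ratPoint_injective hγβ] at hγ
    exact notMem_posSupport_of_mem_negSupport hβ ((mem_circuitsAt.mp hT).1 hγ)
  have hcone : ∀ β ∈ negSupport f, toRatHom n (p β) ∈ W := by
    intro β hβ
    have hpβ := hp β hβ
    generalize p β = r at hpβ ⊢
    induction hpβ using AddSubmonoid.closure_induction with
    | zero => rw [map_zero]; exact zero_mem _
    | add p q _ _ hp hq => rw [map_add]; exact add_mem hp hq
    | mem p hp =>
      obtain ⟨T, hTS, hT, c, d, hc, hd, hage, rfl⟩ := hp
      have hTC := mem_circuitsAt.mpr ⟨hTS, hT⟩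
      have hvw' := hvw β hβ T hTC
      rw [map_sub, map_sum]
      simp only [toRatHom_monomial]
      exact binomialSquareCone_le_indexedSquareCone hβ hTC (hT.mem_binomialSquareCone
        (fun u hu => (hvw' u hu).1) (fun u hu => (hvw' u hu).2.1)
        (fun u hu => (hvw' u hu).2.2.1) (fun u hu => (hvw' u hu).2.2.2)
        (hβmem β hβ T hTC) hc hd hage)
  -- Every vertex of a circuit occurs as some `v u` or `w u`, since its Poisson weight is positive;
  -- a leftover monomial there is a square with one coefficient zero.
  have hcov : ∀ α ∈ posSupport f \ uncoveredSupport f, ratTerm (ratPoint α) (e α) ∈ W := by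
    intro α hα
    obtain ⟨hα₁, hα₂⟩ := Finset.mem_sdiff.mp hα
    rw [mem_uncoveredSupport] at hα₂
    push Not at hα₂
    obtain ⟨β, hβ, T, hTC, hαT⟩ := hα₂ hα₁
    have hvw' := hvw β hβ T hTC
    obtain ⟨-, -, -, -, -, hcover, -⟩ := (mem_circuitsAt.mp hTC).2.exists_green
      (fun u hu => (hvw' u hu).1) (fun u hu => (hvw' u hu).2.1)
      (fun u hu => (hvw' u hu).2.2.1) (fun u hu => (hvw' u hu).2.2.2) (hβmem β hβ T hTC)
    exact binomialSquareCone_le_indexedSquareCone hβ hTC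
      (ratTerm_mem_binomialSquareCone (hcover α hαT) (he α))
  have hsub : uncoveredSupport f ⊆ posSupport f := fun α hα => (mem_uncoveredSupport.mp hα).1
  -- No circuit summand involves an uncovered exponent, so the leftover monomial carries the full
  -- coefficient.
  have he' : ∀ α ∈ uncoveredSupport f, e α = f.coeff α := by
    intro α hα
    conv_rhs => rw [hfe]
    rw [MvPolynomial.coeff_add, MvPolynomial.coeff_sum, MvPolynomial.coeff_sum,
      Finset.sum_eq_zero fun β hβ => coeff_eq_zero_of_mem_circuitCone hα hβ (hp β hβ), zero_add]
    simp [MvPolynomial.coeff_monomial, hsub hα]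
  refine ⟨∑ β ∈ negSupport f, toRatHom n (p β)
    + ∑ α ∈ posSupport f \ uncoveredSupport f, ratTerm (ratPoint α) (e α),
    add_mem (sum_mem hcone) (sum_mem hcov), ?_⟩
  rw [Finset.sum_congr (s₁ := uncoveredSupport f) rfl fun α hα => by rw [← he' α hα], add_assoc,
    Finset.sum_sdiff hsub]
  conv_lhs => rw [← toRatHom_apply, hfe, map_add, map_sum, map_sum]
  simp only [toRatHom_monomial]

end

open scoped Classical in
theorem mainTheorem4 (n : ℕ) (f : MvPolynomial (Fin n) ℝ) (hf : IsPNPolynomial f)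
    (M : (Fin n →₀ ℕ) → Finset (Fin n →₀ ℕ) → Finset (Fin n → ℚ))
    (hM : ∀ β ∈ negSupport f, ∀ T ∈ circuitsAt f β,
      IsRationalMediatedSet (ratPoints T) (M β T) ∧ ratPoint β ∈ M β T)
    (v w : (Fin n →₀ ℕ) → Finset (Fin n →₀ ℕ) → (Fin n → ℚ) → (Fin n → ℚ))
    (hvw : ∀ β ∈ negSupport f, ∀ T ∈ circuitsAt f β, ∀ u ∈ M β T \ ratPoints T,
      v β T u ∈ M β T ∧ w β T u ∈ M β T ∧ v β T u ≠ w β T u ∧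
        u = (1 / 2 : ℚ) • (v β T u + w β T u)) :
    (IsSONC f ↔
      ∃ a b : (Fin n →₀ ℕ) → Finset (Fin n →₀ ℕ) → (Fin n → ℚ) → Fin 2 → ℝ,
        toRatExpPoly f =
          (∑ β ∈ negSupport f, ∑ T ∈ circuitsAt f β, ∑ u ∈ M β T \ ratPoints T, ∑ j : Fin 2,
            binomialSquare (v β T u) (w β T u) (a β T u j) (b β T u j))
          + ∑ α ∈ uncoveredSupport f, ratTerm (ratPoint α) (f.coeff α)) ∧
    (IsSONC f ↔
      ∃ (N : ℕ) (p q : Fin N → (Fin n → ℚ)) (a b : Fin N → ℝ),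
        (∀ j, p j ∈ (negSupport f).biUnion (fun β => (circuitsAt f β).biUnion (M β)) ∧
          q j ∈ (negSupport f).biUnion (fun β => (circuitsAt f β).biUnion (M β))) ∧
        toRatExpPoly f = (∑ j, binomialSquare (p j) (q j) (a j) (b j))
          + ∑ α ∈ uncoveredSupport f, ratTerm (ratPoint α) (f.coeff α)) ∧
    (∀ k : ℕ, 0 < k → (IsSONC f ↔ IsSONC (MvPolynomial.expand k f))) := by
  have hpos : ∀ α ∈ uncoveredSupport f, 0 ≤ f.coeff α := fun α hα =>
    (mem_posSupport.mp (mem_uncoveredSupport.mp hα).1).2.le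
  have h12 : IsSONC f → ∃ a b : (Fin n →₀ ℕ) → Finset (Fin n →₀ ℕ) → (Fin n → ℚ) → Fin 2 → ℝ,
      toRatExpPoly f =
        (∑ β ∈ negSupport f, ∑ T ∈ circuitsAt f β, ∑ u ∈ M β T \ ratPoints T, ∑ j : Fin 2,
          binomialSquare (v β T u) (w β T u) (a β T u j) (b β T u j))
        + ∑ α ∈ uncoveredSupport f, ratTerm (ratPoint α) (f.coeff α) := by
    intro hs
    obtain ⟨g, ⟨a, b, rfl⟩, hg⟩ :=
      hf.exists_binomialSquares (fun β hβ T hT => (hM β hβ T hT).2) hvw hs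
    exact ⟨a, b, hg⟩
  -- Both converse implications reduce to this, because every binomial square lies in `sageCone`.
  have hsage : ∀ g ∈ sageCone n,
      toRatExpPoly f = g + ∑ α ∈ uncoveredSupport f, ratTerm (ratPoint α) (f.coeff α) →
      IsSONC f := by
    intro g hg h
    rw [hf.isSONC_iff, h]
    exact add_mem hg (sum_mem fun α hα => (IsAGE.ratTerm 0 _ (hpos α hα)).mem)
  refine ⟨⟨h12, ?_⟩, ⟨fun hs => ?_, ?_⟩, fun k hk => hf.isSONC_expand_iff hk⟩
  · rintro ⟨a, b, h⟩
    exact hsage _ (sum_mem fun β _ => sum_mem fun T _ => sum_mem fun u _ => sum_mem fun j _ =>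
      binomialSquare_mem_sageCone _ _ _ _) h
  · obtain ⟨a, b, h⟩ := h12 hs
    have hmem : ∑ β ∈ negSupport f, ∑ T ∈ circuitsAt f β, ∑ u ∈ M β T \ ratPoints T, ∑ j : Fin 2,
        binomialSquare (v β T u) (w β T u) (a β T u j) (b β T u j) ∈ AddSubmonoid.closure
        {g | ∃ p ∈ (negSupport f).biUnion (fun β => (circuitsAt f β).biUnion (M β)),
          ∃ q ∈ (negSupport f).biUnion (fun β => (circuitsAt f β).biUnion (M β)),
          ∃ a b : ℝ, g = binomialSquare p q a b} := by
      refine sum_mem fun β hβ => sum_mem fun T hT => sum_mem fun u hu => sum_mem fun j _ =>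
        AddSubmonoid.subset_closure ?_
      have hu' := hvw β hβ T hT u hu
      exact ⟨_, Finset.mem_biUnion.mpr ⟨β, hβ, Finset.mem_biUnion.mpr ⟨T, hT, hu'.1⟩⟩, _,
        Finset.mem_biUnion.mpr ⟨β, hβ, Finset.mem_biUnion.mpr ⟨T, hT, hu'.2.1⟩⟩, _, _, rfl⟩
    obtain ⟨N, p, q, a', b', hpq, heq⟩ := exists_sum_of_mem_closure_binomialSquare hmem
    exact ⟨N, p, q, a', b', hpq, by rw [h, heq]⟩
  · rintro ⟨N, p, q, a, b, -, h⟩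
    exact hsage _ (sum_mem fun j _ => binomialSquare_mem_sageCone _ _ _ _) h
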